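/- **And/or trees and trimming.** Let $k\ge 1$. A $k$-variable and/or tree $\tau$ is a rooted, locally finite (possibly infinite) tree whose internal nodes are labelled by $\land$ or $\lor$ and whose leaves are labelled by literals in $\{x_1,\bar x_1,\dots,x_k,\bar x_k\}$; write $\mathrm{Lab}(w)$ for the literal at a leaf $w$, and $\Lambda(u)$ for the set of children of $u$ that are leaves. Define the constraint sets by $C_r=\emptyset$ for the root $r$ and, for a child $v$ of $u$, $$C_v=C_u\cup\bigcup_{w\in\Lambda(u)}\{\mathrm{Lab}(w)=\mathrm{True}\}\ \text{ if } u \text{ is labelled } \land,\qquad C_v=C_u\cup\bigcup_{w\in\Lambda(u)}\{\mathrm{Lab}(w)=\mathrm{False}\}\ \text{ if } u \text{ is labelled } \lor .$$ A node $v$ is consistent if some assignment of $x_1,\dots,x_k$ satisfies all the constraints in $C_v$. The tree $\mathrm{trim}(\tau)$ consists of the consistent nodes of $\tau$, with their labels, and its size $\|\mathrm{trim}(\tau)\|\in\{0,1,2,\dots,\infty\}$ is the number of its nodes that are leaves of $\tau$. **The random tree.** Let $\xi$ be a random variable with values in $\{0,1,2,\dots\}$ with $\mathbb E\,\xi=1$,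 $\mathbb P(\xi=1)=0$ and $\mathbb E\,e^{a\xi}<\infty$ for some $a>0$. Let $T_\infty$ be the Galton–Watson tree with offspring distribution $\xi$ conditioned on being infinite, that is, the tree with an infinite backbone $u_0,u_1,u_2,\dots$ started at the root $u_0$, in which the numbers of children of the $u_i$ are independent copies of the size-biased variable $\hat\xi$, $\mathbb P(\hat\xi=n)=n\,\mathbb P(\xi=n)$; one of the children of $u_i$, chosen uniformly, is $u_{i+1}$, and the other children of the backbone nodes are the roots of independent unconditioned Galton–Watson trees with offspring distribution $\xi$. Let $\hat T_\infty$ be obtained from $T_\infty$ by giving each internal node a uniform label in $\{\land,\lor\}$ and each leaf a uniform label in $\{x_1,\bar x_1,\dots,x_k,\bar x_k\}$, all labels being independent. **Proposition.** There is a constant $c>0$, depending only on the law of $\xi$, such that for every integer $k\ge1$ and every real $\varpi>1$, $$\mathbb P\big(\|\mathrm{trim}(\hat T_\infty)\|\ge\varpi\big)\le\exp\!\big(-c\,\varpi/k^2\big).$$ If moreover $\mathbb P(\xi\ge3)>0$ (equivalently, if $\xi$ does not take only the values $0$ and $2$), the same bound, with the same $c$, holds for every real $\varpi>0$ and every integer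 $k\ge 1$. -/

import Mathlib

open MeasureTheory
open scoped ENNReal

noncomputable section

/-- A locally finite (possibly infinite) rooted plane tree in Ulam--Harris coding. A node is a word:
`[]` is the root and `i :: u` is the `i`-th child (`i = 0, 1, …`) of `u`; `offspring u` is the number
of children of `u`. The values of `offspring` at words that are not nodes play no role. -/
structure PlaneTree where
  offspring : List ℕ → ℕ

namespace PlaneTree

/-- The word is a node of the tree. -/
def IsNode (t : PlaneTree) : List ℕ → Prop
  | [] => True
  | i :: u => t.IsNode u ∧ i < t.offspring u

/-- The word is a leaf of the tree. -/
def IsLeaf (t : PlaneTree) (u : List ℕ) : Prop :=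
  t.IsNode u ∧ t.offspring u = 0

/-- `Λ(u)`: the children of `u` that are leaves. -/
def leafChildren (t : PlaneTree) (u : List ℕ) : Set (List ℕ) :=
  {w | t.IsLeaf w ∧ ∃ i, w = i :: u}

end PlaneTree

/-- The literals over `k` variables: `(i, true)` is `x_i` and `(i, false)` is its negation. -/
abbrev Literal (k : ℕ) : Type := Fin k × Bool

/-- The truth value of a literal under an assignment of the variables. -/
def Literal.value {k : ℕ} (a : Fin k → Bool) (l : Literal k) : Bool :=
  if l.2 = true then a l.1 else !(a l.1)

/-- A plane tree with connectives at its internal nodes (`conn u = true` for `and`,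
`conn u = false` for `or`) and literals at its leaves. The values of `conn` away from the internal
nodes, and of `lab` away from the leaves, play no role. -/
structure AndOrTree (k : ℕ) extends PlaneTree where
  conn : List ℕ → Bool
  lab : List ℕ → Literal k

namespace AndOrTree

variable {k : ℕ}

/-- The constraint set of a node. The pair `(l, b)` is the constraint `l = b`. Passing from `u` to a
child of `u` adds `lab w = True` for all `w ∈ Λ(u)` if `u` is an `and`, and
`lab w = False` for all `w ∈ Λ(u)` if `u` is an `or`. -/
def constraints (τ : AndOrTree k) : List ℕ → Set (Literal k × Bool)
  | [] => ∅
  | _ :: u => τ.constraints u ∪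
      ⋃ w ∈ τ.leafChildren u, {(τ.lab w, if τ.conn u = true then true else false)}

/-- A node is consistent if some assignment satisfies all of its constraints. -/
def Consistent (τ : AndOrTree k) (u : List ℕ) : Prop :=
  ∃ a : Fin k → Bool, ∀ c ∈ τ.constraints u, Literal.value a c.1 = c.2

/-- The node set of the trimmed tree: the consistent nodes (the labels are those of `τ`). -/
def trim (τ : AndOrTree k) : Set (List ℕ) :=
  {u | τ.IsNode u ∧ τ.Consistent u}

/-- The size of the trimmed tree: the number of its nodes that are leaves of `τ`, that is, of its
leaves that carry a literal. -/
def trimSize (τ : AndOrTree k) : ℕ∞ :=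
  {u | u ∈ τ.trim ∧ τ.IsLeaf u}.encard

end AndOrTree

/-- The law of the pair `(N, J)` where `N` is the size-biased offspring number, `P(N = n) = n p n`,
and, given `N = n`, the rank `J` of the spine child is uniform on `{0, …, n - 1}`. -/
def sizeBiasedPair (p : PMF ℕ) (hp : ∑' n : ℕ, (n : ℝ≥0∞) * p n = 1) : PMF (ℕ × ℕ) :=
  ⟨fun x => if x.2 < x.1 then p x.1 else 0, by
    have h : ∑' x : ℕ × ℕ, (if x.2 < x.1 then p x.1 else 0) = 1 := by
      rw [ENNReal.tsum_prod', ← hp]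
      refine tsum_congr fun n => ?_
      rw [tsum_eq_sum (s := Finset.range n)
        (fun j hj => if_neg (by simpa using hj))]
      rw [Finset.sum_congr rfl (fun j hj => if_pos (by simpa using hj))]
      simp
    rw [← h]
    exact ENNReal.summable.hasSum⟩

/-- The backbone `u_0, u_1, …`: `u_0` is the root, and `u_{n+1}` is the child of `u_n` of rank
`(s n).2`. -/
def spineNode (s : ℕ → ℕ × ℕ) : ℕ → List ℕ
  | 0 => []
  | n + 1 => (s n).2 :: spineNode s n

/-- The tree in which the backbone node `u_n` has `(s n).1` children, of which the one of rank
`(s n).2` is `u_{n+1}`, while every other node `u` has `g u` children. -/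
def spineTree (s : ℕ → ℕ × ℕ) (g : List ℕ → ℕ) : PlaneTree where
  offspring u := open Classical in if u = spineNode s u.length then (s u.length).1 else g u

/-- The sample space: (offspring number, rank of the spine child) along the backbone; offspring
numbers off the backbone; connectives; literals. -/
abbrev Sample (k : ℕ) : Type :=
  (ℕ → ℕ × ℕ) × (List ℕ → ℕ) × (List ℕ → Bool) × (List ℕ → Literal k)

/-- All the coordinates are independent; along the backbone they follow the size-biased law, off the
backbone the law `p`, and the connectives and the literals are uniform. -/
def sampleMeasure (p : PMF ℕ) (hp : ∑' n : ℕ, (n : ℝ≥0∞) * p n = 1) (k : ℕ) [NeZero k] :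
    Measure (Sample k) :=
  (Measure.infinitePi fun _ : ℕ => (sizeBiasedPair p hp).toMeasure).prod <|
    (Measure.infinitePi fun _ : List ℕ => p.toMeasure).prod <|
      (Measure.infinitePi fun _ : List ℕ => (PMF.uniformOfFintype Bool).toMeasure).prod <|
        Measure.infinitePi fun _ : List ℕ => (PMF.uniformOfFintype (Literal k)).toMeasure

/-- Under `sampleMeasure p hp k`, this is the critical Galton--Watson tree with offspring law `p`
conditioned to be infinite, with a uniformly random labelling by connectives and `k`-variable
literals. -/
def labelledInfiniteGW {k : ℕ} (ω : Sample k) : AndOrTree k where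
  toPlaneTree := spineTree ω.1 ω.2.1
  conn := ω.2.2.1
  lab := ω.2.2.2

end

/-!
The tree is explored from the root, carrying along the set `A` of the assignments that satisfy the
constraints met so far. Below a node, `A` shrinks to the assignments that its leaf children allow,
and a node at which `A` becomes empty has no consistent child. The number of consistent leaves of
depth less than `n` is thus computed by a recursion on `n` (`TreeData.count`).

As soon as all assignments in `A` agree on one literal (`Decided A`), a given child of a node is with
probability `P(ξ = 0) / (2 k)` a leaf whose literal contradicts `A`. So the trimmed tree loses a
fraction of order `1 / k` of its mean offspring: it is subcritical with a gap of order `1 / k`.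
For the subtrees off the backbone this gives `E[z ^ count] ≤ 1 + δ / k` with `z = exp (c / k ^ 2)`
(`bushMoment_le_of_decided`), where `δ` and `c` depend only on the law of `ξ`: in the induction on
the depth, killing gains a term of order `(1 / k) * (δ / k)`, which pays for the error of order
`(δ / k) ^ 2` of the expansion of the generating function at `1` and for `z - 1`.
If no literal is decided, a leaf child decides one for its siblings, and the moment is at most
`1 + 2 δ / k` (`bushMoment_le`). Both cases are instances of `bushMoment_succ_le`.

Along the backbone one proves `z ^ m * P(count ≥ m) ≤ 1` by induction on the depth, conditioning on
the children of the root (`pow_mul_spineTail_succ_le`). The leaves in the bushes at the root cost a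
factor `1 + O(δ / k)`; the event, of probability of order `1 / k`, that these children are
inconsistent makes up for it, because nothing then remains to be counted and `m > 0`. This needs no
multiplicative constant. The killing event is available from the root on if `P(ξ ≥ 3) > 0`
(`pow_mul_spineTail_le`), and once a literal is decided in general
(`pow_mul_spineTail_le_of_decided`, which even gives a bound `ρ < 1`). In the binary case without a
decided literal the sibling on the backbone is either a bush or a leaf, and a leaf decides a literal
and leaves at least one more leaf to be found when `m ≥ 2`, so that the bound `ρ` applies
(`pow_mul_spineTail_le_of_binary`).
-/

noncomputable section

/-! ### Product measures over arbitrary index sets -/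

section InfiniteProducts

variable {ι : Type*} {X : ι → Type*} [∀ i, MeasurableSpace (X i)] (μ : ∀ i, Measure (X i))
  [∀ i, IsProbabilityMeasure (μ i)]

/-- Resampling one coordinate does not change the product measure. -/
theorem infinitePi_map_update [DecidableEq ι] (i : ι) :
    ((μ i).prod (Measure.infinitePi μ)).map (fun y => Function.update y.2 i y.1)
      = Measure.infinitePi μ := by
  have hm : Measurable fun y : X i × (∀ j, X j) => Function.update y.2 i y.1 :=
    measurable_update'.comp (measurable_snd.prodMk measurable_fst)
  refine Measure.eq_infinitePi μ fun s t ht => ?_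
  rw [Measure.map_apply hm (.pi s.countable_toSet fun _ _ => ht _)]
  have : (fun y : X i × (∀ j, X j) => Function.update y.2 i y.1) ⁻¹' (Set.pi s t)
      = (if i ∈ s then t i else Set.univ) ×ˢ (Set.pi (s.erase i : Finset ι) t) := by
    ext ⟨x, f⟩
    simp only [Set.mem_preimage, Set.mem_pi, Set.mem_prod, Finset.mem_coe, Finset.mem_erase]
    constructor
    · intro h
      refine ⟨?_, fun j hj => by simpa [Function.update_of_ne hj.1] using h j hj.2⟩
      split_ifs with hi
      · simpa using h i hi
      · trivial
    · rintro ⟨h1, h2⟩ j hj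
      by_cases hji : j = i
      · subst hji
        simpa [hj] using h1
      · simpa [Function.update_of_ne hji] using h2 j ⟨hji, hj⟩
  rw [this, Measure.prod_prod, Measure.infinitePi_pi μ (fun j _ => ht j)]
  by_cases hi : i ∈ s
  · rw [if_pos hi, Finset.mul_prod_erase s (fun j => μ j (t j)) hi]
  · rw [if_neg hi, Finset.erase_eq_of_notMem hi]; simp

/-- Integration against a product measure by resampling the coordinate `i`. -/
theorem lintegral_infinitePi_update [DecidableEq ι] (i : ι) {F : (∀ j, X j) → ℝ≥0∞}
    (hF : Measurable F) :
    ∫⁻ f, F f ∂(Measure.infinitePi μ)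
      = ∫⁻ x, ∫⁻ f, F (Function.update f i x) ∂(Measure.infinitePi μ) ∂(μ i) := by
  have hm : Measurable fun y : X i × (∀ j, X j) => Function.update y.2 i y.1 :=
    measurable_update'.comp (measurable_snd.prodMk measurable_fst)
  conv_lhs => rw [← infinitePi_map_update μ i]
  rw [lintegral_map hF hm]
  exact lintegral_prod (fun y => F (Function.update y.2 i y.1)) (hF.comp hm).aemeasurable

/-- A coordinate is independent of the family of the other ones. -/
theorem infinitePi_map_eval_comp {κ : Type*} (i : ι) {e : κ → ι} (he : Function.Injective e)
    (hei : ∀ j, e j ≠ i) :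
    (Measure.infinitePi μ).map (fun f => (f i, fun j => f (e j)))
      = (μ i).prod (Measure.infinitePi fun j => μ (e j)) := by
  classical
  have hm : Measurable fun y : X i × (∀ j, X j) => Function.update y.2 i y.1 :=
    measurable_update'.comp (measurable_snd.prodMk measurable_fst)
  conv_lhs => rw [← infinitePi_map_update μ i]
  rw [Measure.map_map (by fun_prop) hm, ← Measure.map_infinitePi_infinitePi_of_inj he]
  have : (fun f : ∀ j, X j => (f i, fun j => f (e j))) ∘
      (fun y : X i × (∀ j, X j) => Function.update y.2 i y.1)
      = Prod.map id (fun f j => f (e j)) := by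
    ext y
    · simp
    · simp [Function.update_of_ne (hei _)]
  rw [this, ← Measure.map_prod_map _ _ measurable_id (by fun_prop), Measure.map_id]

/-- The integral of a product of functions of distinct coordinates. -/
theorem lintegral_infinitePi_prod (s : Finset ι) {h : ∀ i, X i → ℝ≥0∞}
    (hh : ∀ i, Measurable (h i)) :
    ∫⁻ f, ∏ i ∈ s, h i (f i) ∂(Measure.infinitePi μ) = ∏ i ∈ s, ∫⁻ x, h i x ∂(μ i) := by
  refine (ProbabilityTheory.lintegral_prod_eq_prod_lintegral_of_indepFun s 
    (fun i (f : ∀ j, X j) => h i (f i)) (ProbabilityTheory.iIndepFun_infinitePi hh)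
    (fun i => (hh i).comp (measurable_pi_apply i))).trans ?_
  refine Finset.prod_congr rfl fun i _ => ?_
  rw [← Measure.infinitePi_map_eval μ i, lintegral_map (hh i) (by fun_prop)]

end InfiniteProducts

/-- Zipping two independent families of independent variables gives an independent family of
pairs. -/
theorem infinitePi_prod_map_zip {ι α β : Type*} [MeasurableSpace α] [MeasurableSpace β]
    (μ : Measure α) (ν : Measure β) [IsProbabilityMeasure μ] [IsProbabilityMeasure ν] :
    ((Measure.infinitePi fun _ : ι => μ).prod (Measure.infinitePi fun _ : ι => ν)).map
        (fun y i => (y.1 i, y.2 i))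
      = Measure.infinitePi fun _ : ι => μ.prod ν := by
  refine (Measure.isProjectiveLimit_infinitePi fun _ : ι => μ.prod ν).unique (fun I => ?_) |>.symm
  rw [Measure.map_map (by fun_prop) (by fun_prop)]
  have h1 : (Finset.restrict I (π := fun _ => α × β)) ∘
      (fun (y : (ι → α) × (ι → β)) i => (y.1 i, y.2 i))
      = (MeasurableEquiv.arrowProdEquivProdArrow α β I).symm ∘
        Prod.map (Finset.restrict I) (Finset.restrict I) := rfl
  rw [h1, ← Measure.map_map (by fun_prop) (by fun_prop),
    ← Measure.map_prod_map _ _ (by fun_prop) (by fun_prop),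
    Measure.infinitePi_map_restrict, Measure.infinitePi_map_restrict]
  exact ((measurePreserving_arrowProdEquivProdArrow α β I (fun _ => μ) (fun _ => ν)).symm _).map_eq

/-! ### Counting the leaves of the trimmed tree recursively -/

/-- The offspring numbers, connectives and literals of an and/or tree, gathered in one function on
words, so that a random tree is a point of a product space. -/
abbrev TreeData (k : ℕ) : Type := List ℕ → ℕ × Bool × Literal k

namespace TreeData

variable {k : ℕ}

/-- The and/or tree with the given data. -/
def toTree (t : TreeData k) : AndOrTree k where
  offspring u := (t u).1
  conn u := (t u).2.1
  lab u := (t u).2.2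

/-- The subtree at the `i`-th child of the root. Words list the ranks from the node up to the root,
so descending from the root appends at the end. -/
def child (t : TreeData k) (i : ℕ) : TreeData k := fun u => t (u ++ [i])

/-- The root is a leaf. -/
def RootIsLeaf (t : TreeData k) : Prop := (t []).1 = 0

/-- The assignments allowed by the tree `t` when it hangs from a node with connective `c`: there is
a constraint only if `t` is a single leaf. -/
def allowed (c : Bool) (t : TreeData k) : Set (Fin k → Bool) :=
  {a | t.RootIsLeaf → Literal.value a (t []).2.2 = c}

/-- The assignments allowed by the trees `f i`, `i ∈ s`, when they hang from a node with
connective `c`. -/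
def allowedOn (s : Finset ℕ) (c : Bool) (f : ℕ → TreeData k) : Set (Fin k → Bool) :=
  {a | ∀ i ∈ s, a ∈ allowed c (f i)}

/-- The assignments that satisfy the constraints imposed by the leaf children of the root. -/
def rootAllowed (t : TreeData k) : Set (Fin k → Bool) :=
  allowedOn (Finset.range (t []).1) (t []).2.1 t.child

open Classical in
/-- The number of leaves of depth less than `n` that are consistent with some assignment in `A`, by
recursion on `n`: below the root, `A` shrinks to the assignments that the root allows. -/
def count : ℕ → Set (Fin k → Bool) → TreeData k → ℕ
  | 0, _, _ => 0
  | n + 1, A, t =>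
    if t.RootIsLeaf then (if A.Nonempty then 1 else 0)
    else ∑ i ∈ Finset.range (t []).1, count n (A ∩ t.rootAllowed) (t.child i)

theorem count_empty (n : ℕ) (t : TreeData k) : count n ∅ t = 0 := by
  induction n generalizing t with
  | zero => rfl
  | succ n ih => simp [count, ih]

theorem count_mono (n : ℕ) (t : TreeData k) {A B : Set (Fin k → Bool)} (h : A ⊆ B) :
    count n A t ≤ count n B t := by
  induction n generalizing t A B with
  | zero => rfl
  | succ n ih =>
    simp only [count]
    split_ifs with h1 h2 h3
    · rfl
    · exact absurd (h2.mono h) h3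
    · exact Nat.zero_le _
    · rfl
    · exact Finset.sum_le_sum fun i _ => ih _ (Set.inter_subset_inter_left _ h)

theorem count_le_one_of_rootIsLeaf (n : ℕ) (A : Set (Fin k → Bool)) {t : TreeData k}
    (h : t.RootIsLeaf) : count n A t ≤ 1 := by
  cases n with
  | zero => simp [count]
  | succ n =>
    simp only [count, if_pos h]
    split_ifs <;> simp

theorem isNode_append (t : TreeData k) (u : List ℕ) (i : ℕ) :
    t.toTree.IsNode (u ++ [i]) ↔ i < (t []).1 ∧ (t.child i).toTree.IsNode u := by
  induction u with
  | nil => simp [PlaneTree.IsNode, toTree]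
  | cons j u ih =>
    simp only [List.cons_append, PlaneTree.IsNode, ih, and_assoc]
    rfl

theorem isLeaf_append (t : TreeData k) (u : List ℕ) (i : ℕ) :
    t.toTree.IsLeaf (u ++ [i]) ↔ i < (t []).1 ∧ (t.child i).toTree.IsLeaf u := by
  simp only [PlaneTree.IsLeaf, isNode_append, and_assoc]
  rfl

/-- The assignment satisfies all the constraints of the node. -/
def Satisfies (τ : AndOrTree k) (a : Fin k → Bool) (u : List ℕ) : Prop :=
  ∀ c ∈ τ.constraints u, Literal.value a c.1 = c.2

theorem satisfies_cons (τ : AndOrTree k) (a : Fin k → Bool) (j : ℕ) (u : List ℕ) :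
    Satisfies τ a (j :: u) ↔ Satisfies τ a u ∧
      ∀ i, τ.IsLeaf (i :: u) → Literal.value a (τ.lab (i :: u)) = τ.conn u := by
  simp only [Satisfies, AndOrTree.constraints, Set.mem_union, Set.mem_iUnion, Set.mem_singleton_iff,
    PlaneTree.leafChildren, Set.mem_ofPred_eq]
  constructor
  · intro h
    refine ⟨fun c hc => h c (Or.inl hc), fun i hi => ?_⟩
    have := h _ (Or.inr ⟨i :: u, ⟨hi, i, rfl⟩, rfl⟩)
    simpa using this
  · rintro ⟨h1, h2⟩ c (hc | ⟨w, ⟨hw, i, rfl⟩, rfl⟩)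
    · exact h1 c hc
    · simpa using h2 i hw

theorem satisfies_append (t : TreeData k) (a : Fin k → Bool) (u : List ℕ) {i : ℕ}
    (hi : i < (t []).1) :
    Satisfies t.toTree a (u ++ [i]) ↔ a ∈ t.rootAllowed ∧ Satisfies (t.child i).toTree a u := by
  induction u with
  | nil =>
    rw [List.nil_append, satisfies_cons]
    have h0 : ∀ τ : AndOrTree k, Satisfies τ a [] := fun τ c hc => absurd hc (by
      simp [AndOrTree.constraints])
    simp only [h0, true_and, and_true, rootAllowed, allowedOn, allowed, Set.mem_ofPred_eq,
      Finset.mem_range]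
    refine forall_congr' fun j => ?_
    simp only [PlaneTree.IsLeaf, PlaneTree.IsNode, toTree, RootIsLeaf, child, List.nil_append,
      true_and, and_imp]
  | cons j u ih =>
    rw [List.cons_append, satisfies_cons, satisfies_cons, ih, and_assoc]
    refine and_congr_right fun _ => and_congr_right fun _ => forall_congr' fun l => ?_
    rw [← List.cons_append, isLeaf_append]
    simp only [hi, true_and]
    rfl

/-- The leaves of depth less than `n` that are consistent with some assignment in `A`. -/
def consistentLeaves (n : ℕ) (A : Set (Fin k → Bool)) (t : TreeData k) : Set (List ℕ) :=
  {u | u.length < n ∧ t.toTree.IsLeaf u ∧ ∃ a ∈ A, Satisfies t.toTree a u}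

theorem encard_consistentLeaves_le (n : ℕ) (A : Set (Fin k → Bool)) (t : TreeData k) :
    (consistentLeaves n A t).encard ≤ count n A t := by
  induction n generalizing A t with
  | zero => simp [consistentLeaves, count]
  | succ n ih =>
    by_cases h : t.RootIsLeaf
    · have hsub : consistentLeaves (n + 1) A t ⊆ {[]} := by
        rintro u ⟨-, hu, -⟩
        rcases List.eq_nil_or_concat u with rfl | ⟨v, i, rfl⟩
        · rfl
        · rw [List.concat_eq_append, isLeaf_append] at hu
          rw [RootIsLeaf] at h
          omega
      simp only [count, if_pos h]
      split_ifs with hA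
      · exact (Set.encard_le_encard hsub).trans (by simp)
      · have : consistentLeaves (n + 1) A t = ∅ := by
          refine Set.eq_empty_of_forall_notMem fun u => ?_
          rintro ⟨-, -, a, ha, -⟩
          exact hA ⟨a, ha⟩
        simp [this]
    · simp only [count, if_neg h]
      have hsub : consistentLeaves (n + 1) A t ⊆ ⋃ i ∈ Finset.range (t []).1,
          (fun u => u ++ [i]) '' consistentLeaves n (A ∩ t.rootAllowed) (t.child i) := by
        rintro u ⟨hlen, hu, a, ha, hs⟩
        rcases List.eq_nil_or_concat u with rfl | ⟨v, i, rfl⟩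
        · exact absurd hu.2 h
        · rw [List.concat_eq_append] at *
          obtain ⟨hi, hv⟩ := (isLeaf_append t v i).1 hu
          rw [satisfies_append t a v hi] at hs
          simp only [Set.mem_iUnion, Finset.mem_range]
          exact ⟨i, hi, v, ⟨by simpa using hlen, hv, a, ⟨ha, hs.1⟩, hs.2⟩, rfl⟩
      refine (Set.encard_le_encard hsub).trans ?_
      have hgen : ∀ s : Finset ℕ, (⋃ i ∈ s, (fun u => u ++ [i]) ''
          consistentLeaves n (A ∩ t.rootAllowed) (t.child i)).encard
          ≤ ((∑ i ∈ s, count n (A ∩ t.rootAllowed) (t.child i) : ℕ) : ℕ∞) := by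
        intro s
        induction s using Finset.induction_on with
        | empty => simp
        | insert i s his ihs =>
          rw [Finset.set_biUnion_insert, Finset.sum_insert his]
          push_cast
          refine (Set.encard_union_le _ _).trans (add_le_add ?_ (by exact_mod_cast ihs))
          exact (Set.encard_image_le _ _).trans (ih _ _)
      exact hgen _

theorem trim_leaves_eq_iUnion (t : TreeData k) :
    {u | u ∈ t.toTree.trim ∧ t.toTree.IsLeaf u} = ⋃ n, consistentLeaves n Set.univ t := by
  ext u
  simp only [AndOrTree.trim, AndOrTree.Consistent, consistentLeaves, Satisfies, Set.mem_ofPred_eq,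
    Set.mem_iUnion, Set.mem_univ, true_and]
  constructor
  · rintro ⟨⟨-, ha⟩, hl⟩
    exact ⟨u.length + 1, Nat.lt_succ_self _, hl, ha⟩
  · rintro ⟨n, -, hl, ha⟩
    exact ⟨⟨hl.1, ha⟩, hl⟩

/-- A large trimmed tree already has many leaves up to some finite depth. -/
theorem exists_le_encard_of_le_trimSize {t : TreeData k} {m : ℕ} (h : m ≤ t.toTree.trimSize) :
    ∃ n, (m : ℕ∞) ≤ (consistentLeaves n Set.univ t).encard := by
  rw [AndOrTree.trimSize, trim_leaves_eq_iUnion] at h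
  obtain ⟨s, hs, hcard⟩ := Set.exists_subset_encard_eq h
  have hfin : s.Finite := Set.finite_of_encard_eq_coe hcard
  have hmono : Monotone fun n => consistentLeaves n Set.univ t :=
    fun n n' hn u hu => ⟨hu.1.trans_le hn, hu.2⟩
  obtain ⟨n, hn⟩ := hmono.directed_le.exists_mem_subset_of_finset_subset_biUnion
    (s := hfin.toFinset) (by simpa using hs)
  exact ⟨n, hcard ▸ Set.encard_le_encard (by simpa using hn)⟩

/-! ### Measurability -/

theorem measurable_child (i : ℕ) : Measurable fun t : TreeData k => t.child i := by
  unfold child; fun_prop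

theorem measurableSet_rootIsLeaf : MeasurableSet {t : TreeData k | t.RootIsLeaf} := by
  have : Measurable fun t : TreeData k => (t []).1 := by fun_prop
  exact this (measurableSet_singleton 0)

theorem measurable_value_comp {α : Type*} [MeasurableSpace α] {f : α → Literal k}
    (hf : Measurable f) (a : Fin k → Bool) : Measurable fun x => Literal.value a (f x) :=
  (measurable_of_countable fun l => Literal.value a l).comp hf

theorem measurableSet_mem_allowed (a : Fin k → Bool) :
    MeasurableSet {y : Bool × TreeData k | a ∈ allowed y.1 y.2} := by
  have h1 : MeasurableSet {y : Bool × TreeData k | y.2.RootIsLeaf} :=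
    measurable_snd measurableSet_rootIsLeaf
  have h2 : MeasurableSet {y : Bool × TreeData k | Literal.value a (y.2 []).2.2 = y.1} :=
    measurableSet_eq_fun (measurable_value_comp (by fun_prop) a) measurable_fst
  exact h1.imp h2

theorem measurable_allowedOn (s : Finset ℕ) :
    Measurable fun y : Bool × (ℕ → TreeData k) => allowedOn s y.1 y.2 := by
  refine measurable_set_iff.2 fun a => ?_
  refine measurableSet_setOfPred.1 ?_
  have : {y : Bool × (ℕ → TreeData k) | a ∈ allowedOn s y.1 y.2}
      = ⋂ i ∈ s, {y | a ∈ allowed y.1 (y.2 i)} := by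
    ext y; simp [allowedOn]
  rw [this]
  refine .biInter s.countable_toSet fun i _ => ?_
  have hm : Measurable fun y : Bool × (ℕ → TreeData k) => (y.1, y.2 i) := by fun_prop
  exact hm (measurableSet_mem_allowed a)

/-- The total count of the trees `f i`, `i ∈ s`, hanging from a node with connective `c`, when the
assignments are restricted to `A` and by the leaves among these trees. -/
def countOn (n : ℕ) (A : Set (Fin k → Bool)) (s : Finset ℕ) (c : Bool) (f : ℕ → TreeData k) : ℕ :=
  ∑ i ∈ s, count n (A ∩ allowedOn s c f) (f i)

theorem count_succ_of_not_rootIsLeaf (n : ℕ) (A : Set (Fin k → Bool)) {t : TreeData k}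
    (h : ¬ t.RootIsLeaf) :
    count (n + 1) A t = countOn n A (Finset.range (t []).1) (t []).2.1 t.child := by
  simp only [count, if_neg h]
  rfl

theorem measurable_count_prod {n : ℕ} (h : ∀ A : Set (Fin k → Bool), Measurable (count n A)) :
    Measurable fun y : Set (Fin k → Bool) × TreeData k => count n y.1 y.2 :=
  measurable_from_prod_countable_right h

theorem measurable_countOn {n : ℕ} (h : ∀ A : Set (Fin k → Bool), Measurable (count n A))
    (A : Set (Fin k → Bool)) (s : Finset ℕ) :
    Measurable fun y : Bool × (ℕ → TreeData k) => countOn n A s y.1 y.2 := by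
  refine Finset.measurable_fun_sum s fun i _ => (measurable_count_prod h).comp (.prodMk ?_ ?_)
  · exact (measurable_of_countable fun B : Set (Fin k → Bool) => A ∩ B).comp
      (measurable_allowedOn s)
  · fun_prop

theorem measurable_count (n : ℕ) (A : Set (Fin k → Bool)) : Measurable (count n A) := by
  induction n generalizing A with
  | zero => exact measurable_const
  | succ n ih =>
    have h1 : Measurable fun y : ℕ × (Bool × (ℕ → TreeData k)) =>
        countOn n A (Finset.range y.1) y.2.1 y.2.2 :=
      measurable_from_prod_countable_right fun N => measurable_countOn ih A (Finset.range N)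
    have h2 : Measurable fun t : TreeData k => ((t []).1, ((t []).2.1, t.child)) :=
      .prodMk (by fun_prop) (.prodMk (by fun_prop) (measurable_pi_lambda _ measurable_child))
    have h3 : Measurable fun t : TreeData k =>
        countOn n A (Finset.range (t []).1) (t []).2.1 t.child := by
      have h := h1.comp h2
      rwa [Function.comp_def] at h
    classical
    have h4 : count (n + 1) A = fun t : TreeData k =>
        if t.RootIsLeaf then (if A.Nonempty then 1 else 0)
        else countOn n A (Finset.range (t []).1) (t []).2.1 t.child := by
      funext t
      by_cases ht : t.RootIsLeaf
      · simp only [count, if_pos ht]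
      · rw [count_succ_of_not_rootIsLeaf n A ht, if_neg ht]
    rw [h4]
    exact Measurable.ite measurableSet_rootIsLeaf measurable_const h3

end TreeData

/-! ### The laws of the labelled trees and their decomposition at the root -/

theorem measurable_root_child (k : ℕ) :
    Measurable fun t : TreeData k => (t [], t.child) :=
  .prodMk (by fun_prop) (measurable_pi_lambda _ TreeData.measurable_child)

section Laws

variable (p : PMF ℕ) (k : ℕ) [NeZero k]

/-- The law of the data of one node off the backbone. -/
def nodeLaw : Measure (ℕ × Bool × Literal k) :=
  p.toMeasure.prod
    ((PMF.uniformOfFintype Bool).toMeasure.prod (PMF.uniformOfFintype (Literal k)).toMeasure)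

instance : IsProbabilityMeasure (nodeLaw p k) := by unfold nodeLaw; infer_instance

/-- The law of the labelled unconditioned Galton--Watson tree. -/
def gwLaw : Measure (TreeData k) := Measure.infinitePi fun _ => nodeLaw p k

instance : IsProbabilityMeasure (gwLaw p k) := by unfold gwLaw; infer_instance

/-- The law of a sequence of independent labelled Galton--Watson trees. -/
def forestLaw : Measure (ℕ → TreeData k) := Measure.infinitePi fun _ => gwLaw p k

instance : IsProbabilityMeasure (forestLaw p k) := by unfold forestLaw; infer_instance

/-- Branching property: the root and the subtrees at its children are independent. -/
theorem gwLaw_map_root :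
    (gwLaw p k).map (fun t => (t [], t.child)) = (nodeLaw p k).prod (forestLaw p k) := by
  have he : Function.Injective fun y : ℕ × List ℕ => y.2 ++ [y.1] := by
    rintro ⟨i, u⟩ ⟨j, v⟩ h
    obtain ⟨rfl, h⟩ := List.append_inj' h rfl
    simpa using h
  have h1 := infinitePi_map_eval_comp (fun _ : List ℕ => nodeLaw p k) [] he (by simp)
  have h2 := Measure.infinitePi_map_curry (fun (_ : ℕ) (_ : List ℕ) => nodeLaw p k)
  have h3 : (fun t : TreeData k => (t [], t.child))
      = Prod.map id (MeasurableEquiv.curry ℕ (List ℕ) (ℕ × Bool × Literal k)) ∘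
        (fun t => (t [], fun y : ℕ × List ℕ => t (y.2 ++ [y.1]))) := rfl
  rw [h3, ← Measure.map_map (by fun_prop) (by fun_prop), gwLaw, h1,
    ← Measure.map_prod_map _ _ measurable_id (by fun_prop), Measure.map_id, h2]
  rfl

theorem lintegral_gwLaw {G : (ℕ × Bool × Literal k) × (ℕ → TreeData k) → ℝ≥0∞}
    (hG : Measurable G) :
    ∫⁻ t, G (t [], t.child) ∂(gwLaw p k)
      = ∫⁻ d, ∫⁻ f, G (d, f) ∂(forestLaw p k) ∂(nodeLaw p k) := by
  rw [← lintegral_prod _ hG.aemeasurable, ← gwLaw_map_root,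
    lintegral_map hG (measurable_root_child k)]

theorem lintegral_forestLaw_prod (s : Finset ℕ) {h : TreeData k → ℝ≥0∞} (hh : Measurable h) :
    ∫⁻ f, ∏ i ∈ s, h (f i) ∂(forestLaw p k) = (∫⁻ t, h t ∂(gwLaw p k)) ^ s.card := by
  rw [forestLaw, lintegral_infinitePi_prod (fun _ => gwLaw p k) s (h := fun _ => h) fun _ => hh,
    Finset.prod_const]

theorem lintegral_forestLaw_update (i : ℕ) {F : (ℕ → TreeData k) → ℝ≥0∞} (hF : Measurable F) :
    ∫⁻ f, F f ∂(forestLaw p k)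
      = ∫⁻ t, ∫⁻ f, F (Function.update f i t) ∂(forestLaw p k) ∂(gwLaw p k) :=
  lintegral_infinitePi_update (fun _ => gwLaw p k) i hF

theorem gwLaw_rootIsLeaf : gwLaw p k {t | t.RootIsLeaf} = p 0 := by
  have h : {t : TreeData k | t.RootIsLeaf}
      = (fun t => t []) ⁻¹' ({0} ×ˢ Set.univ) := by
    ext t; simp [TreeData.RootIsLeaf]
  rw [h, ← Measure.map_apply (measurable_pi_apply _) (by measurability), gwLaw, Measure.infinitePi_map_eval,
    nodeLaw, Measure.prod_prod]
  simp [PMF.toMeasure_apply_singleton]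

theorem gwLaw_rootIsLeaf_and_eq (l : Literal k) :
    gwLaw p k {t | t.RootIsLeaf ∧ (t []).2.2 = l} = p 0 * (2 * k : ℝ≥0∞)⁻¹ := by
  have h : {t : TreeData k | t.RootIsLeaf ∧ (t []).2.2 = l}
      = (fun t => t []) ⁻¹' ({0} ×ˢ (Set.univ ×ˢ {l})) := by
    ext t; simp [TreeData.RootIsLeaf]
  rw [h, ← Measure.map_apply (measurable_pi_apply _) (by measurability), gwLaw, Measure.infinitePi_map_eval,
    nodeLaw, Measure.prod_prod, Measure.prod_prod]
  have h2 : (2 : ℝ≥0∞) * 2⁻¹ = 1 := ENNReal.mul_inv_cancel (by simp) (by simp)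
  simp [PMF.toMeasure_apply_singleton, mul_comm, h2]

variable {p} (hp : ∑' n : ℕ, (n : ℝ≥0∞) * p n = 1)

/-- The law of the backbone: offspring numbers and ranks of the backbone children. -/
def backboneLaw : Measure (ℕ → ℕ × ℕ) :=
  Measure.infinitePi fun _ => (sizeBiasedPair p hp).toMeasure

instance : IsProbabilityMeasure (backboneLaw hp) := by unfold backboneLaw; infer_instance

theorem backboneLaw_map_root :
    (backboneLaw hp).map (fun s => (s 0, fun n => s (n + 1)))
      = (sizeBiasedPair p hp).toMeasure.prod (backboneLaw hp) :=
  infinitePi_map_eval_comp (fun _ : ℕ => (sizeBiasedPair p hp).toMeasure) 0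
    Nat.succ_injective fun _ => Nat.succ_ne_zero _

/-- The joint law of the backbone and of the data at all words. -/
def backboneTreeLaw : Measure ((ℕ → ℕ × ℕ) × TreeData k) :=
  (backboneLaw hp).prod (gwLaw p k)

instance : IsProbabilityMeasure (backboneTreeLaw k hp) := by
  unfold backboneTreeLaw; infer_instance

/-- Decomposition at the root of the tree with a backbone: the root, the trees at the children off
the backbone, and the tree at the backbone child, which has the law of the whole tree, are
independent. The function `G` may depend on the trees `f` hanging from the root only through those
off the backbone. -/
theorem lintegral_backboneTreeLaw
    {G : (ℕ × ℕ) × ((ℕ × Bool × Literal k) × (ℕ → TreeData k)) ×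
      ((ℕ → ℕ × ℕ) × TreeData k) → ℝ≥0∞} (hG : Measurable G)
    (hinv : ∀ y d f t ω, G (y, (d, Function.update f y.2 t), ω) = G (y, (d, f), ω)) :
    ∫⁻ ω, G (ω.1 0, (ω.2 [], ω.2.child), (fun n => ω.1 (n + 1), ω.2.child (ω.1 0).2))
        ∂(backboneTreeLaw k hp)
      = ∫⁻ y, ∫⁻ d, ∫⁻ f, ∫⁻ ω, G (y, (d, f), ω) ∂(backboneTreeLaw k hp)
          ∂(forestLaw p k) ∂(nodeLaw p k) ∂(sizeBiasedPair p hp).toMeasure := by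
  have hev : Measurable fun z : (ℕ → TreeData k) × ℕ => z.1 z.2 :=
    measurable_from_prod_countable_left fun i => measurable_pi_apply i
  have hG1 : Measurable fun z : ((ℕ × ℕ) × (ℕ → ℕ × ℕ)) ×
      ((ℕ × Bool × Literal k) × (ℕ → TreeData k)) =>
      G (z.1.1, z.2, (z.1.2, z.2.2 z.1.1.2)) := by
    refine hG.comp (.prodMk (by fun_prop) (.prodMk (by fun_prop) (.prodMk (by fun_prop) ?_)))
    exact hev.comp (.prodMk (by fun_prop) (by fun_prop))
  have hmap : (backboneTreeLaw k hp).map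
      (Prod.map (fun s : ℕ → ℕ × ℕ => (s 0, fun n => s (n + 1)))
        (fun t : TreeData k => (t [], t.child)))
      = ((sizeBiasedPair p hp).toMeasure.prod (backboneLaw hp)).prod
          ((nodeLaw p k).prod (forestLaw p k)) := by
    rw [backboneTreeLaw, ← Measure.map_prod_map _ _ (by fun_prop) (measurable_root_child k),
      backboneLaw_map_root, gwLaw_map_root]
  have hmm : Measurable (Prod.map (fun s : ℕ → ℕ × ℕ => (s 0, fun n => s (n + 1)))
        (fun t : TreeData k => (t [], t.child))) :=
    .prodMap (by fun_prop) (measurable_root_child k)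
  refine (lintegral_map hG1 hmm).symm.trans ?_
  rw [hmap, lintegral_prod _ hG1.aemeasurable,
    lintegral_prod _ hG1.lintegral_prod_right'.aemeasurable]
  refine lintegral_congr fun y => ?_
  -- For a fixed root of the backbone, the integral over the rest `s` of the backbone moves inside.
  have hG2 : Measurable fun z : (ℕ → ℕ × ℕ) × ((ℕ × Bool × Literal k) × (ℕ → TreeData k)) =>
      G (y, z.2, (z.1, z.2.2 y.2)) := by
    exact hG1.comp (f := fun z : (ℕ → ℕ × ℕ) × ((ℕ × Bool × Literal k) × (ℕ → TreeData k)) =>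
      ((y, z.1), z.2)) (by fun_prop)
  rw [lintegral_lintegral_swap hG2.aemeasurable,
    lintegral_prod _ hG2.lintegral_prod_left'.aemeasurable]
  refine lintegral_congr fun d => ?_
  have hG3 : Measurable fun z : (ℕ → TreeData k) × (ℕ → ℕ × ℕ) =>
      G (y, (d, z.1), (z.2, z.1 y.2)) := by
    exact hG2.comp (f := fun z : (ℕ → TreeData k) × (ℕ → ℕ × ℕ) => (z.2, (d, z.1))) (by fun_prop)
  rw [lintegral_forestLaw_update p k y.2 hG3.lintegral_prod_right']
  simp only [hinv, Function.update_self]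
  have hG4 : Measurable fun z : (ℕ → TreeData k) × ((ℕ → ℕ × ℕ) × TreeData k) =>
      G (y, (d, z.1), z.2) := by
    exact hG.comp (.prodMk (by fun_prop) (.prodMk (by fun_prop) (by fun_prop)))
  have hG5 : Measurable fun z : TreeData k × (ℕ → TreeData k) =>
      ∫⁻ s, G (y, (d, z.2), (s, z.1)) ∂(backboneLaw hp) := by
    refine Measurable.lintegral_prod_right' (f := fun z : (TreeData k × (ℕ → TreeData k)) ×
      (ℕ → ℕ × ℕ) => G (y, (d, z.1.2), (z.2, z.1.1))) ?_
    exact hG4.comp (f := fun z : (TreeData k × (ℕ → TreeData k)) × (ℕ → ℕ × ℕ) =>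
      (z.1.2, (z.2, z.1.1))) (by fun_prop)
  rw [lintegral_lintegral_swap hG5.aemeasurable]
  refine lintegral_congr fun f => ?_
  have hG6 : Measurable fun ω : (ℕ → ℕ × ℕ) × TreeData k => G (y, (d, f), ω) := by
    exact hG4.comp (f := fun ω => (f, ω)) (by fun_prop)
  rw [backboneTreeLaw, lintegral_prod_symm _ hG6.aemeasurable]

end Laws

/-! ### The tree with a backbone -/

/-- The data of the tree in which the backbone is given by the first component and the rest by the
second. -/
def spineData {k : ℕ} (ω : (ℕ → ℕ × ℕ) × TreeData k) : TreeData k := fun u =>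
  ((spineTree ω.1 fun v => (ω.2 v).1).offspring u, (ω.2 u).2)

theorem spineNode_succ (s : ℕ → ℕ × ℕ) (n : ℕ) :
    spineNode s (n + 1) = spineNode (fun m => s (m + 1)) n ++ [(s 0).2] := by
  induction n with
  | zero => simp [spineNode]
  | succ n ih =>
    rw [spineNode, ih, spineNode]
    rfl

theorem child_spineData_self {k : ℕ} (ω : (ℕ → ℕ × ℕ) × TreeData k) :
    (spineData ω).child (ω.1 0).2
      = spineData (fun n => ω.1 (n + 1), ω.2.child (ω.1 0).2) := by
  funext u
  simp [spineData, spineTree, TreeData.child, spineNode_succ]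

theorem child_spineData_of_ne {k : ℕ} (ω : (ℕ → ℕ × ℕ) × TreeData k) {i : ℕ}
    (h : i ≠ (ω.1 0).2) : (spineData ω).child i = ω.2.child i := by
  funext u
  simp [spineData, spineTree, TreeData.child, spineNode_succ, h]

theorem spineData_nil {k : ℕ} (ω : (ℕ → ℕ × ℕ) × TreeData k) :
    spineData ω [] = ((ω.1 0).1, (ω.2 []).2) := by
  simp [spineData, spineTree, spineNode]

theorem measurableSet_eq_spineNode (u : List ℕ) (n : ℕ) :
    MeasurableSet {s : ℕ → ℕ × ℕ | u = spineNode s n} := by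
  induction n generalizing u with
  | zero => exact MeasurableSet.const (u = [])
  | succ n ih =>
    cases u with
    | nil => simp [spineNode]
    | cons i v =>
      have h : {s : ℕ → ℕ × ℕ | i :: v = spineNode s (n + 1)}
          = {s | i = (s n).2} ∩ {s | v = spineNode s n} := by
        ext s; simp [spineNode]
      rw [h]
      exact (measurableSet_eq_fun measurable_const (by fun_prop)).inter (ih v)

theorem measurable_spineData {k : ℕ} :
    Measurable (spineData : (ℕ → ℕ × ℕ) × TreeData k → TreeData k) := by
  classical
  refine measurable_pi_lambda _ fun u => .prodMk ?_ (by fun_prop)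
  exact Measurable.ite (measurable_fst (measurableSet_eq_spineNode u u.length)) (by fun_prop)
    (by fun_prop)

/-- The sampled tree in terms of the backbone and of independent data at all words. -/
theorem sampleMeasure_map (p : PMF ℕ) (hp : ∑' n : ℕ, (n : ℝ≥0∞) * p n = 1) (k : ℕ) [NeZero k] :
    (sampleMeasure p hp k).map (fun ω => (ω.1, fun u => (ω.2.1 u, ω.2.2.1 u, ω.2.2.2 u)))
      = backboneTreeLaw k hp := by
  have h : (fun ω : Sample k => (ω.1, fun u => (ω.2.1 u, ω.2.2.1 u, ω.2.2.2 u)))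
      = Prod.map id ((fun (y : (List ℕ → ℕ) × (List ℕ → Bool × Literal k)) u => (y.1 u, y.2 u)) ∘
          Prod.map id (fun (y : (List ℕ → Bool) × (List ℕ → Literal k)) u => (y.1 u, y.2 u))) :=
    rfl
  rw [h, sampleMeasure, ← Measure.map_prod_map _ _ measurable_id (by fun_prop), Measure.map_id,
    ← Measure.map_map (by fun_prop) (by fun_prop),
    ← Measure.map_prod_map _ _ measurable_id (by fun_prop), Measure.map_id,
    infinitePi_prod_map_zip, infinitePi_prod_map_zip]
  rfl

theorem toTree_spineData {k : ℕ} (ω : Sample k) :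
    (spineData (ω.1, fun u => (ω.2.1 u, ω.2.2.1 u, ω.2.2.2 u))).toTree
      = labelledInfiniteGW ω := rfl

/-! ### Exponential moments of the trimmed Galton--Watson tree -/

theorem PMF.tsum_mul_ite_zero (p : PMF ℕ) (b : ℝ≥0∞) :
    ∑' N, p N * (if N = 0 then 1 else b) = p 0 + (1 - p 0) * b := by
  have h : ∀ N, p N * (if N = 0 then 1 else b)
      = (if N = 0 then p 0 else 0) + (if N = 0 then 0 else p N) * b := by
    intro N; split_ifs with h <;> simp [h]
  have h1 : ∑' N, (if N = 0 then p 0 else 0) = p 0 := tsum_ite_eq 0 _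
  have h2 : p 0 + ∑' N, (if N = 0 then 0 else p N) = 1 := by
    rw [← p.tsum_coe, ← h1, ← ENNReal.tsum_add]
    exact tsum_congr fun N => by split_ifs with h <;> simp [h]
  simp only [h]
  rw [ENNReal.tsum_add, h1, ENNReal.tsum_mul_right, ← h2,
    ENNReal.add_sub_cancel_left (p.apply_ne_top 0)]

section Bush

variable {k : ℕ}

/-- All the assignments in `A` give the same value to some literal. -/
def Decided (A : Set (Fin k → Bool)) : Prop :=
  ∃ (l : Literal k) (b : Bool), ∀ a ∈ A, Literal.value a l = b

theorem Decided.mono {A B : Set (Fin k → Bool)} (hB : Decided B) (h : A ⊆ B) : Decided A := by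
  obtain ⟨l, b, hl⟩ := hB
  exact ⟨l, b, fun a ha => hl a (h ha)⟩

/-- If `A` decides a literal, then for each connective some literal of a leaf child is inconsistent
with `A`: the decided literal or its negation. -/
theorem Decided.exists_ne {A : Set (Fin k → Bool)} (hA : Decided A) (c : Bool) :
    ∃ l : Literal k, ∀ a ∈ A, Literal.value a l ≠ c := by
  obtain ⟨⟨i, s⟩, b, hl⟩ := hA
  by_cases hbc : b = c
  · refine ⟨(i, !s), fun a ha => ?_⟩
    have := hl a ha
    subst hbc
    rw [← this]
    cases s <;> simp [Literal.value]
  · exact ⟨(i, s), fun a ha => by rw [hl a ha]; exact hbc⟩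

theorem decided_inter_allowed (A : Set (Fin k → Bool)) (c : Bool) {t : TreeData k}
    (ht : t.RootIsLeaf) : Decided (A ∩ TreeData.allowed c t) :=
  ⟨_, c, fun _ ha => ha.2 ht⟩

theorem inter_allowed_eq_empty {A : Set (Fin k → Bool)} {c : Bool} {t : TreeData k}
    (ht : t.RootIsLeaf) (h : ∀ a ∈ A, Literal.value a (t []).2.2 ≠ c) :
    A ∩ TreeData.allowed c t = ∅ :=
  Set.eq_empty_of_forall_notMem fun a ha => h a ha.1 (ha.2 ht)

theorem allowedOn_subset_allowed {s : Finset ℕ} (c : Bool) (f : ℕ → TreeData k) {j : ℕ}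
    (hj : j ∈ s) : TreeData.allowedOn s c f ⊆ TreeData.allowed c (f j) :=
  fun _ ha => ha j hj

theorem countOn_le (n : ℕ) (A : Set (Fin k → Bool)) (s : Finset ℕ) (c : Bool)
    (f : ℕ → TreeData k) :
    TreeData.countOn n A s c f ≤ ∑ i ∈ s, TreeData.count n A (f i) :=
  Finset.sum_le_sum fun _ _ => TreeData.count_mono _ _ Set.inter_subset_left

/-- Only the constraint imposed by the child `j` is kept, for the other children. -/
theorem countOn_le_add (n : ℕ) (A : Set (Fin k → Bool)) {s : Finset ℕ} (c : Bool)
    (f : ℕ → TreeData k) {j : ℕ} (hj : j ∈ s) :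
    TreeData.countOn n A s c f ≤ TreeData.count n A (f j)
      + ∑ i ∈ s.erase j, TreeData.count n (A ∩ TreeData.allowed c (f j)) (f i) := by
  rw [TreeData.countOn, ← Finset.add_sum_erase s _ hj]
  exact add_le_add (TreeData.count_mono _ _ Set.inter_subset_left) (Finset.sum_le_sum fun _ _ =>
    TreeData.count_mono _ _ (Set.inter_subset_inter_right _ (allowedOn_subset_allowed c f hj)))

theorem one_add_pow_add_le (w v : ℝ≥0∞) (m : ℕ) :
    (1 + w) ^ (m + 1) + v ≤ (1 + w + v) ^ (m + 1) := by
  have h1 : 1 ≤ (1 + w + v) ^ m := one_le_pow₀ (by rw [add_assoc]; exact le_self_add)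
  calc (1 + w) ^ (m + 1) + v ≤ (1 + w + v) ^ m * (1 + w) + (1 + w + v) ^ m * v := by
        rw [pow_succ]
        refine add_le_add (mul_le_mul_left (pow_le_pow_left₀ zero_le ?_ m) _)
          (le_mul_of_one_le_left zero_le h1)
        exact le_self_add
    _ = (1 + w + v) ^ (m + 1) := by
        rw [← mul_add, pow_succ]

theorem measurable_pow_count (z : ℝ≥0∞) (n : ℕ) (A : Set (Fin k → Bool)) :
    Measurable fun t : TreeData k => z ^ TreeData.count n A t :=
  (measurable_of_countable fun m : ℕ => z ^ m).comp (TreeData.measurable_count n A)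

theorem measurable_prod_pow_count (z : ℝ≥0∞) (n : ℕ) (A : Set (Fin k → Bool)) (s : Finset ℕ) :
    Measurable fun f : ℕ → TreeData k => ∏ i ∈ s, z ^ TreeData.count n A (f i) := by
  refine Finset.measurable_fun_prod _ fun i _ => ?_
  exact (measurable_pow_count z n A).comp (g := fun t => z ^ TreeData.count n A t)
    (f := fun f : ℕ → TreeData k => f i) (measurable_pi_apply i)

variable [NeZero k] (p : PMF ℕ) (z : ℝ≥0∞)

/-- The exponential moment of the number of leaves of depth less than `n` consistent with `A`, in
the unconditioned tree. The variable `z` is the exponential of the parameter. -/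
def bushMoment (n : ℕ) (A : Set (Fin k → Bool)) : ℝ≥0∞ :=
  ∫⁻ t, z ^ TreeData.count n A t ∂(gwLaw p k)

theorem bushMoment_empty (n : ℕ) : bushMoment p z n (∅ : Set (Fin k → Bool)) = 1 := by
  simp [bushMoment, TreeData.count_empty]

theorem lintegral_toMeasure_eq_tsum (h : ℕ → ℝ≥0∞) :
    ∫⁻ N, h N ∂p.toMeasure = ∑' N, p N * h N := by
  rw [lintegral_countable']
  exact tsum_congr fun N => by rw [PMF.toMeasure_apply_singleton _ _ (by simp), mul_comm]

theorem lintegral_nodeLaw_fst (h : ℕ → ℝ≥0∞) :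
    ∫⁻ d, h d.1 ∂(nodeLaw p k) = ∑' N, p N * h N := by
  rw [← lintegral_toMeasure_eq_tsum p, nodeLaw]
  rw [lintegral_prod _ (by fun_prop)]
  simp

variable {z} (hz : 1 ≤ z)
include hz

theorem bushMoment_mono (n : ℕ) {A B : Set (Fin k → Bool)} (h : A ⊆ B) :
    bushMoment p z n A ≤ bushMoment p z n B :=
  lintegral_mono fun t => pow_le_pow_right₀ hz (TreeData.count_mono n t h)

/-- If the child `0` lies with probability at least `κ` in a set `E` of trees whose presence
improves the bound on the moments of the other children from `1 + w + v` to `1 + w`, then the bound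
on the moment of the whole forest improves by `κ * v`. -/
theorem lintegral_pow_countOn_add_le {n : ℕ} {A : Set (Fin k → Bool)} {w v κ : ℝ≥0∞}
    (hA : bushMoment p z n A ≤ 1 + w + v) (c : Bool) {E : Set (TreeData k)}
    (hE : MeasurableSet E) (hκ : κ ≤ gwLaw p k E)
    (hEw : ∀ t ∈ E, bushMoment p z n (A ∩ TreeData.allowed c t) ≤ 1 + w) {N : ℕ} (hN : 2 ≤ N) :
    ∫⁻ f, z ^ TreeData.countOn n A (Finset.range N) c f ∂(forestLaw p k) + κ * v
      ≤ (1 + w + v) ^ N := by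
  classical
  obtain ⟨m, rfl⟩ : ∃ m, N = m + 1 + 1 := ⟨N - 2, by omega⟩
  have hmeas : Measurable fun f : ℕ → TreeData k =>
      z ^ TreeData.countOn n A (Finset.range (m + 1 + 1)) c f := by
    have h := TreeData.measurable_countOn (TreeData.measurable_count n) A (Finset.range (m + 1 + 1))
    have h' := h.comp (f := fun f : ℕ → TreeData k => (c, f)) (by fun_prop)
    exact (measurable_of_countable fun m : ℕ => z ^ m).comp h'
  have hinner : ∀ t : TreeData k,
      ∫⁻ f, z ^ TreeData.countOn n A (Finset.range (m + 1 + 1)) c (Function.update f 0 t)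
        ∂(forestLaw p k)
      ≤ z ^ TreeData.count n A t *
        (if t ∈ E then (1 + w) ^ (m + 1) else (1 + w + v) ^ (m + 1)) := by
    intro t
    set C : Set (Fin k → Bool) := A ∩ TreeData.allowed c t with hC
    have hC' : bushMoment p z n C ^ (m + 1)
        ≤ if t ∈ E then (1 + w) ^ (m + 1) else (1 + w + v) ^ (m + 1) := by
      split_ifs with ht
      · gcongr
        exact hEw t ht
      · gcongr
        exact (bushMoment_mono p hz n Set.inter_subset_left).trans hA
    refine le_trans ?_ (mul_le_mul_right hC' _)
    have hcard : ((Finset.range (m + 1 + 1)).erase 0).card = m + 1 := by simp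
    calc _ ≤ ∫⁻ f, z ^ TreeData.count n A t *
          ∏ i ∈ (Finset.range (m + 1 + 1)).erase 0, z ^ TreeData.count n C (f i)
            ∂(forestLaw p k) := by
          refine lintegral_mono fun f => ?_
          rw [Finset.prod_pow_eq_pow_sum, ← pow_add]
          refine pow_le_pow_right₀ hz ((countOn_le_add n A c _ (j := 0) (by simp)).trans ?_)
          simp only [Function.update_self]
          refine add_le_add le_rfl (Finset.sum_le_sum fun i hi => ?_)
          rw [Function.update_of_ne (Finset.ne_of_mem_erase hi)]
      _ = _ := by
          rw [lintegral_const_mul _ (measurable_prod_pow_count z n C _),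
            lintegral_forestLaw_prod p k _ (measurable_pow_count z n C), hcard]
          rfl
  rw [lintegral_forestLaw_update p k 0 hmeas]
  have hind : κ * v ≤ ∫⁻ t, E.indicator (fun _ => v) t ∂(gwLaw p k) := by
    rw [lintegral_indicator_const hE, mul_comm]
    gcongr
  calc _ ≤ ∫⁻ t, z ^ TreeData.count n A t *
          (if t ∈ E then (1 + w) ^ (m + 1) else (1 + w + v) ^ (m + 1)) ∂(gwLaw p k)
        + ∫⁻ t, E.indicator (fun _ => v) t ∂(gwLaw p k) :=
        add_le_add (lintegral_mono hinner) hind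
    _ = ∫⁻ t, z ^ TreeData.count n A t *
          (if t ∈ E then (1 + w) ^ (m + 1) else (1 + w + v) ^ (m + 1))
          + E.indicator (fun _ => v) t ∂(gwLaw p k) :=
        (lintegral_add_right _ (measurable_const.indicator hE)).symm
    _ ≤ ∫⁻ t, z ^ TreeData.count n A t * (1 + w + v) ^ (m + 1) ∂(gwLaw p k) := by
        refine lintegral_mono fun t => ?_
        by_cases ht : t ∈ E
        · simp only [if_pos ht, Set.indicator_of_mem ht]
          refine le_trans ?_ (mul_le_mul_right (one_add_pow_add_le w v m) _)
          rw [mul_add]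
          gcongr
          exact le_mul_of_one_le_left' (one_le_pow₀ hz)
        · simp [if_neg ht, Set.indicator_of_notMem ht]
    _ = bushMoment p z n A * (1 + w + v) ^ (m + 1) :=
        lintegral_mul_const _ (measurable_pow_count z n A)
    _ ≤ (1 + w + v) ^ (m + 1 + 1) := by
        rw [pow_succ' _ (m + 1)]
        gcongr

/-- The inductive step for the moments of the unconditioned tree. In `hnum` the term `p 0 * z` stands
for a root that is a leaf, and `p 0` on the right-hand side compensates for the term `N = 0` of the
generating function; the gain `κ * v` occurs when the root has children. -/
theorem bushMoment_succ_le (hp1 : p 1 = 0) {n : ℕ} {A : Set (Fin k → Bool)} {w v κ : ℝ≥0∞}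
    (hA : bushMoment p z n A ≤ 1 + w + v) {E : Bool → Set (TreeData k)}
    (hE : ∀ c, MeasurableSet (E c)) (hκ : ∀ c, κ ≤ gwLaw p k (E c))
    (hEw : ∀ c, ∀ t ∈ E c, bushMoment p z n (A ∩ TreeData.allowed c t) ≤ 1 + w)
    (hfin : κ * v ≠ ∞)
    (hnum : p 0 * z + ∑' N, p N * (1 + w + v) ^ N ≤ 1 + w + v + (p 0 + (1 - p 0) * (κ * v))) :
    bushMoment p z (n + 1) A ≤ 1 + w + v := by
  classical
  have hp0 : p 0 ≤ 1 := p.coe_le_one 0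
  have hm : Measurable fun y : (ℕ × Bool × Literal k) × (ℕ → TreeData k) =>
      if y.1.1 = 0 then z else z ^ TreeData.countOn n A (Finset.range y.1.1) y.1.2.1 y.2 := by
    have h1 : Measurable fun y : ℕ × (Bool × (ℕ → TreeData k)) =>
        if y.1 = 0 then z else z ^ TreeData.countOn n A (Finset.range y.1) y.2.1 y.2.2 := by
      refine measurable_from_prod_countable_right fun N => ?_
      dsimp only
      split_ifs
      · exact measurable_const
      · exact (measurable_of_countable fun m : ℕ => z ^ m).comp
          (TreeData.measurable_countOn (TreeData.measurable_count n) A (Finset.range N))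
    have h := h1.comp (f := fun y : (ℕ × Bool × Literal k) × (ℕ → TreeData k) =>
      (y.1.1, (y.1.2.1, y.2))) (by fun_prop)
    rwa [Function.comp_def] at h
  have hroot : bushMoment p z (n + 1) A ≤ ∫⁻ d, ∫⁻ f, (if d.1 = 0 then z else
      z ^ TreeData.countOn n A (Finset.range d.1) d.2.1 f) ∂(forestLaw p k) ∂(nodeLaw p k) := by
    rw [← lintegral_gwLaw p k hm]
    refine lintegral_mono fun t => ?_
    by_cases ht : t.RootIsLeaf
    · have ht' : (t []).1 = 0 := ht
      simp only [if_pos ht']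
      calc z ^ TreeData.count (n + 1) A t ≤ z ^ 1 :=
            pow_le_pow_right₀ hz (TreeData.count_le_one_of_rootIsLeaf _ _ ht)
        _ = z := pow_one z
    · have ht' : ¬ (t []).1 = 0 := ht
      simp only [if_neg ht', TreeData.count_succ_of_not_rootIsLeaf n A ht]
      exact le_rfl
  have hae : ∀ᵐ d ∂(nodeLaw p k), d.1 ≠ 1 := by
    have h : nodeLaw p k {d | d.1 = 1} = 0 := by
      have h' : {d : ℕ × Bool × Literal k | d.1 = 1} = {1} ×ˢ Set.univ := by ext d; simp
      rw [h', nodeLaw, Measure.prod_prod, PMF.toMeasure_apply_singleton _ _ (by simp), hp1, zero_mul]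
    exact measure_eq_zero_iff_ae_notMem.1 h
  have hsum := p.tsum_mul_ite_zero (κ * v)
  have hsum0 : ∑' N, p N * (if N = 0 then z else 0) = p 0 * z := by
    rw [tsum_eq_single 0 (fun N hN => by simp [hN])]; simp
  have key : bushMoment p z (n + 1) A + (p 0 + (1 - p 0) * (κ * v))
      ≤ (1 + w + v) + (p 0 + (1 - p 0) * (κ * v)) := by
    refine le_trans ?_ hnum
    rw [← hsum, ← hsum0, ← ENNReal.tsum_add]
    simp only [← mul_add]
    rw [← lintegral_nodeLaw_fst p (k := k) fun N => if N = 0 then 1 else κ * v,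
      ← lintegral_nodeLaw_fst p (k := k) fun N => (if N = 0 then z else 0) + (1 + w + v) ^ N]
    refine (add_le_add_left hroot _).trans ?_
    have hmr : Measurable fun d : ℕ × Bool × Literal k => if d.1 = 0 then 1 else κ * v :=
      (measurable_of_countable fun N : ℕ => if N = 0 then 1 else κ * v).comp measurable_fst
    rw [← lintegral_add_right _ hmr]
    refine lintegral_mono_ae ?_
    filter_upwards [hae] with d hd
    by_cases h0 : d.1 = 0
    · simp [h0]
    · simp only [if_neg h0, zero_add]
      exact lintegral_pow_countOn_add_le p hz hA _ (hE _) (hκ _) (hEw _) (by omega)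
  refine (ENNReal.add_le_add_iff_right ?_).1 key
  refine ENNReal.add_ne_top.2 ⟨ne_top_of_le_ne_top ENNReal.one_ne_top hp0, ?_⟩
  exact ENNReal.mul_ne_top (ne_top_of_le_ne_top ENNReal.one_ne_top tsub_le_self) hfin

/-- Once a variable is decided, the first child is with probability at least `p 0 / (2 k)` a leaf
that kills all the children: the tree is subcritical. -/
theorem bushMoment_le_of_decided (hp1 : p 1 = 0) {x : ℝ≥0∞} (hx : x ≠ ∞)
    (hnum : p 0 * z + ∑' N, p N * (1 + x) ^ N
      ≤ 1 + x + (p 0 + (1 - p 0) * (p 0 * (2 * k : ℝ≥0∞)⁻¹ * x)))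
    (n : ℕ) {A : Set (Fin k → Bool)} (hA : Decided A) : bushMoment p z n A ≤ 1 + x := by
  induction n with
  | zero => simp [bushMoment, TreeData.count]
  | succ n ih =>
    choose l hl using hA.exists_ne
    have hk : (2 * k : ℝ≥0∞) ≠ 0 := by simpa using NeZero.ne k
    have := bushMoment_succ_le p hz hp1 (n := n) (A := A) (w := 0) (v := x)
      (κ := p 0 * (2 * k : ℝ≥0∞)⁻¹) (E := fun c => {t | t.RootIsLeaf ∧ (t []).2.2 = l c})
      (by simpa using ih) (fun c => ?_) (fun c => (gwLaw_rootIsLeaf_and_eq p k (l c)).ge)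
      (fun c t ht => ?_) ?_ (by simpa using hnum)
    · simpa using this
    · exact TreeData.measurableSet_rootIsLeaf.inter
        (measurableSet_eq_fun (by fun_prop) measurable_const)
    · rw [inter_allowed_eq_empty ht.1 (by rw [ht.2]; exact hl c), bushMoment_empty, add_zero]
    · refine ENNReal.mul_ne_top (ENNReal.mul_ne_top ?_ (ENNReal.inv_ne_top.2 hk)) hx
      exact p.apply_ne_top 0

/-- With no variable decided, the first child is with probability `p 0` a leaf, which decides a
variable for its siblings. -/
theorem bushMoment_le (hp1 : p 1 = 0) {x : ℝ≥0∞} (hx : x ≠ ∞)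
    (hdec : ∀ (n : ℕ) (A : Set (Fin k → Bool)), Decided A → bushMoment p z n A ≤ 1 + x)
    (hnum : p 0 * z + ∑' N, p N * (1 + x + x) ^ N ≤ 1 + x + x + (p 0 + (1 - p 0) * (p 0 * x)))
    (n : ℕ) (A : Set (Fin k → Bool)) : bushMoment p z n A ≤ 1 + x + x := by
  induction n with
  | zero => simp [bushMoment, TreeData.count, add_assoc]
  | succ n ih =>
    exact bushMoment_succ_le p hz hp1 (n := n) (A := A) (w := x) (v := x)
      (κ := p 0) (E := fun _ => {t | t.RootIsLeaf}) ih
      (fun _ => TreeData.measurableSet_rootIsLeaf) (fun _ => (gwLaw_rootIsLeaf p k).ge)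
      (fun c t ht => hdec _ _ (decided_inter_allowed A c ht))
      (ENNReal.mul_ne_top (p.apply_ne_top 0) hx) hnum

end Bush

/-! ### Tail of the trimmed tree with a backbone -/

theorem sizeBiasedPair_ae {p : PMF ℕ} (hp : ∑' n : ℕ, (n : ℝ≥0∞) * p n = 1) :
    ∀ᵐ y ∂(sizeBiasedPair p hp).toMeasure, y.2 < y.1 ∧ p y.1 ≠ 0 := by
  rw [ae_iff_of_countable]
  intro y hy
  rw [PMF.toMeasure_apply_singleton _ _ (by simp)] at hy
  have hy' : (if y.2 < y.1 then p y.1 else 0) ≠ 0 := hy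
  by_cases h : y.2 < y.1
  · exact ⟨h, by rwa [if_pos h] at hy'⟩
  · exact absurd (if_neg h) hy'

theorem lintegral_sizeBiasedPair_fst {p : PMF ℕ} (hp : ∑' n : ℕ, (n : ℝ≥0∞) * p n = 1)
    (h : ℕ → ℝ≥0∞) :
    ∫⁻ y, h y.1 ∂(sizeBiasedPair p hp).toMeasure = ∑' N : ℕ, N * p N * h N := by
  rw [lintegral_countable', ENNReal.tsum_prod']
  refine tsum_congr fun N => ?_
  have h1 : ∀ J : ℕ, h N * (sizeBiasedPair p hp).toMeasure {(N, J)}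
      = if J < N then h N * p N else 0 := by
    intro J
    rw [PMF.toMeasure_apply_singleton _ _ (by simp)]
    change h N * (if J < N then p N else 0) = _
    split_ifs <;> simp
  simp only [h1]
  rw [tsum_eq_sum (s := Finset.range N) (fun J hJ => if_neg (by simpa using hJ)),
    Finset.sum_congr rfl (fun J hJ => if_pos (by simpa using hJ))]
  simp only [Finset.sum_const, Finset.card_range, nsmul_eq_mul]
  ring

section Siblings

variable {k : ℕ}

/-- The children of the root off the backbone. -/
def siblings (y : ℕ × ℕ) : Finset ℕ := (Finset.range y.1).erase y.2

theorem card_siblings {y : ℕ × ℕ} (h : y.2 < y.1) : (siblings y).card = y.1 - 1 := by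
  rw [siblings, Finset.card_erase_of_mem (by simpa using h), Finset.card_range]

theorem countOn_update_of_notMem (n : ℕ) (A : Set (Fin k → Bool)) {s : Finset ℕ} (c : Bool)
    (f : ℕ → TreeData k) {j : ℕ} (hj : j ∉ s) (t : TreeData k) :
    TreeData.allowedOn s c (Function.update f j t) = TreeData.allowedOn s c f ∧
      TreeData.countOn n A s c (Function.update f j t) = TreeData.countOn n A s c f := by
  have h : ∀ i ∈ s, Function.update f j t i = f i := fun i hi =>
    Function.update_of_ne (ne_of_mem_of_not_mem hi hj) _ _
  have h1 : TreeData.allowedOn s c (Function.update f j t) = TreeData.allowedOn s c f := by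
    ext a
    exact forall₂_congr fun i hi => by rw [h i hi]
  refine ⟨h1, ?_⟩
  rw [TreeData.countOn, TreeData.countOn, h1]
  exact Finset.sum_congr rfl fun i hi => by rw [h i hi]

theorem count_succ_spineData_le (n : ℕ) (A : Set (Fin k → Bool)) (ω : (ℕ → ℕ × ℕ) × TreeData k)
    (h : (ω.1 0).2 < (ω.1 0).1) :
    TreeData.count (n + 1) A (spineData ω)
      ≤ TreeData.countOn n A (siblings (ω.1 0)) (ω.2 []).2.1 ω.2.child
        + TreeData.count n (A ∩ TreeData.allowedOn (siblings (ω.1 0)) (ω.2 []).2.1 ω.2.child)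
            (spineData (fun i => ω.1 (i + 1), ω.2.child (ω.1 0).2)) := by
  have hroot : ¬ (spineData ω).RootIsLeaf := by
    rw [TreeData.RootIsLeaf, spineData_nil]
    dsimp only
    omega
  have hall : TreeData.allowedOn (Finset.range (ω.1 0).1) (ω.2 []).2.1 (spineData ω).child
      ⊆ TreeData.allowedOn (siblings (ω.1 0)) (ω.2 []).2.1 ω.2.child := by
    intro a ha i hi
    rw [← child_spineData_of_ne ω (Finset.ne_of_mem_erase hi)]
    exact ha i (Finset.mem_of_mem_erase hi)
  rw [TreeData.count_succ_of_not_rootIsLeaf n A hroot, spineData_nil, TreeData.countOn,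
    ← Finset.sum_erase_add _ _ (Finset.mem_range.2 h), child_spineData_self]
  refine add_le_add (Finset.sum_le_sum fun i hi => ?_)
    (TreeData.count_mono _ _ (Set.inter_subset_inter_right _ hall))
  rw [child_spineData_of_ne ω (Finset.ne_of_mem_erase hi)]
  exact TreeData.count_mono _ _ (Set.inter_subset_inter_right _ hall)

end Siblings

section Spine

variable {p : PMF ℕ} {k : ℕ} [NeZero k] (hp : ∑' n : ℕ, (n : ℝ≥0∞) * p n = 1)

/-- The probability that the tree with a backbone has at least `m` leaves of depth less than `n`
that are consistent with `A`. -/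
def spineTail (n : ℕ) (A : Set (Fin k → Bool)) (m : ℕ) : ℝ≥0∞ :=
  backboneTreeLaw k hp {ω | m ≤ TreeData.count n A (spineData ω)}

theorem spineTail_le_one (n : ℕ) (A : Set (Fin k → Bool)) (m : ℕ) : spineTail hp n A m ≤ 1 :=
  prob_le_one

theorem spineTail_empty (n : ℕ) {m : ℕ} (hm : m ≠ 0) :
    spineTail hp n (∅ : Set (Fin k → Bool)) m = 0 := by
  simp [spineTail, TreeData.count_empty, hm]

theorem spineTail_zero_left (A : Set (Fin k → Bool)) {m : ℕ} (hm : m ≠ 0) :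
    spineTail hp 0 A m = 0 := by
  simp [spineTail, TreeData.count, hm]

/-- The weighted conditional probability, given the children `f` of the root off the backbone, that
the tree has at least `m` consistent leaves: the root of the backbone child sees the assignments
that these children allow, and these children bring their own leaves. -/
def conditionalTail (z : ℝ≥0∞) (n : ℕ) (A : Set (Fin k → Bool)) (m : ℕ) (s : Finset ℕ) (c : Bool)
    (f : ℕ → TreeData k) : ℝ≥0∞ :=
  z ^ TreeData.countOn n A s c f * (z ^ (m - TreeData.countOn n A s c f) *
    spineTail hp n (A ∩ TreeData.allowedOn s c f) (m - TreeData.countOn n A s c f))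

/-- Markov property at the root of the backbone. -/
theorem pow_mul_spineTail_succ_le {z : ℝ≥0∞} (hz : 1 ≤ z) (hz' : z ≠ ∞) (n : ℕ)
    (A : Set (Fin k → Bool)) (m : ℕ) :
    z ^ m * spineTail hp (n + 1) A m
      ≤ ∫⁻ y, ∫⁻ d, ∫⁻ f, conditionalTail hp z n A m (siblings y) d.2.1 f
          ∂(forestLaw p k) ∂(nodeLaw p k) ∂(sizeBiasedPair p hp).toMeasure := by
  -- The number of consistent leaves, as a function of the independent components.
  let X : (ℕ × ℕ) × ((ℕ × Bool × Literal k) × (ℕ → TreeData k)) ×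
      ((ℕ → ℕ × ℕ) × TreeData k) → ℕ := fun x =>
    TreeData.countOn n A (siblings x.1) x.2.1.1.2.1 x.2.1.2
      + TreeData.count n (A ∩ TreeData.allowedOn (siblings x.1) x.2.1.1.2.1 x.2.1.2)
          (spineData x.2.2)
  have hX : Measurable X := by
    refine measurable_from_prod_countable_right fun y => ?_
    have hcf : Measurable fun x : ((ℕ × Bool × Literal k) × (ℕ → TreeData k)) ×
      ((ℕ → ℕ × ℕ) × TreeData k) => (x.1.1.2.1, x.1.2) := by fun_prop
    have h1 := (TreeData.measurable_countOn (TreeData.measurable_count n) A (siblings y)).comp hcf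
    have h2 := (TreeData.measurable_allowedOn (siblings y)).comp hcf
    have h3 := (measurable_of_countable fun B : Set (Fin k → Bool) => A ∩ B).comp h2
    have h4 := (TreeData.measurable_count_prod (TreeData.measurable_count n)).comp
      (h3.prodMk (measurable_spineData.comp measurable_snd))
    exact h1.add h4
  let G : (ℕ × ℕ) × ((ℕ × Bool × Literal k) × (ℕ → TreeData k)) ×
      ((ℕ → ℕ × ℕ) × TreeData k) → ℝ≥0∞ := fun x => if m ≤ X x then 1 else 0
  have hG : Measurable G := Measurable.ite (measurableSet_le measurable_const hX)
    measurable_const measurable_const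
  have hinv : ∀ y d f t ω, G (y, (d, Function.update f y.2 t), ω) = G (y, (d, f), ω) := by
    intro y d f t ω
    have hnot : y.2 ∉ siblings y := Finset.notMem_erase _ _
    have h := countOn_update_of_notMem n A d.2.1 f hnot t
    have hXX : X (y, (d, Function.update f y.2 t), ω) = X (y, (d, f), ω) := by
      simp only [X, h.1, h.2]
    simp only [G, hXX]
  have hae : ∀ᵐ ω ∂(backboneTreeLaw k hp), (ω.1 0).2 < (ω.1 0).1 := by
    have h0 := (sizeBiasedPair_ae hp).mono fun y hy => hy.1
    have h1 : MeasurePreserving (fun s : ℕ → ℕ × ℕ => s 0) (backboneLaw hp)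
        (sizeBiasedPair p hp).toMeasure := measurePreserving_eval_infinitePi _ 0
    exact Measure.quasiMeasurePreserving_fst.ae (h1.quasiMeasurePreserving.ae h0)
  have htail : spineTail hp (n + 1) A m ≤ ∫⁻ ω, G (ω.1 0, (ω.2 [], ω.2.child),
      (fun n => ω.1 (n + 1), ω.2.child (ω.1 0).2)) ∂(backboneTreeLaw k hp) := by
    have hset : MeasurableSet {ω | m ≤ TreeData.count (n + 1) A (spineData (k := k) ω)} :=
      measurableSet_le measurable_const
        ((TreeData.measurable_count (n + 1) A).comp measurable_spineData)
    rw [spineTail, ← lintegral_indicator_one hset]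
    refine lintegral_mono_ae (hae.mono fun ω hω => ?_)
    by_cases hm : m ≤ TreeData.count (n + 1) A (spineData ω)
    · have hm' : m ≤ X (ω.1 0, (ω.2 [], ω.2.child),
          (fun n => ω.1 (n + 1), ω.2.child (ω.1 0).2)) :=
        hm.trans (count_succ_spineData_le n A ω hω)
      simp [G, hm, hm']
    · simp [hm]
  rw [lintegral_backboneTreeLaw k hp hG hinv] at htail
  refine (mul_le_mul_right htail _).trans ?_
  have hzm : z ^ m ≠ ∞ := ENNReal.pow_ne_top hz'
  rw [← lintegral_const_mul' _ _ hzm]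
  refine lintegral_mono fun y => ?_
  rw [← lintegral_const_mul' _ _ hzm]
  refine lintegral_mono fun d => ?_
  rw [← lintegral_const_mul' _ _ hzm]
  refine lintegral_mono fun f => ?_
  have hin : ∫⁻ ω, G (y, (d, f), ω) ∂(backboneTreeLaw k hp)
      = spineTail hp n (A ∩ TreeData.allowedOn (siblings y) d.2.1 f)
        (m - TreeData.countOn n A (siblings y) d.2.1 f) := by
    have hXm : Measurable fun ω => X (y, (d, f), ω) :=
      hX.comp (f := fun ω => (y, (d, f), ω)) (by fun_prop)
    rw [spineTail, ← lintegral_indicator_one]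
    · refine lintegral_congr fun ω => ?_
      simp only [G, X, Set.indicator_apply, Set.mem_ofPred_eq, tsub_le_iff_left, Pi.one_apply]
    · exact measurableSet_le measurable_const
        ((TreeData.measurable_count n _).comp measurable_spineData)
  dsimp only
  rw [hin, conditionalTail, ← mul_assoc, ← pow_add]
  exact mul_le_mul_left (pow_le_pow_right₀ hz (by omega)) _

end Spine

/-! ### Killing along the backbone -/

section SpineBounds

theorem lintegral_add_lintegral_le {α : Type*} [MeasurableSpace α] {μ : Measure α}
    {F g G : α → ℝ≥0∞} (hg : Measurable g) (h : ∀ᵐ x ∂μ, F x + g x ≤ G x) :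
    ∫⁻ x, F x ∂μ + ∫⁻ x, g x ∂μ ≤ ∫⁻ x, G x ∂μ := by
  rw [← lintegral_add_right _ hg]
  exact lintegral_mono_ae h

theorem lintegral_add_le_of_forall {α : Type*} [MeasurableSpace α] {μ : Measure α}
    [IsProbabilityMeasure μ] {F : α → ℝ≥0∞} {a b : ℝ≥0∞} (h : ∀ᵐ x ∂μ, F x + a ≤ b) :
    ∫⁻ x, F x ∂μ + a ≤ b := by
  simpa using lintegral_add_lintegral_le (g := fun _ => a) (G := fun _ => b) measurable_const h

theorem measurableSet_apply_rootIsLeaf {k : ℕ} (j : ℕ) :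
    MeasurableSet {f : ℕ → TreeData k | (f j).RootIsLeaf} := by
  have h : Measurable fun f : ℕ → TreeData k => (f j []).1 := by fun_prop
  exact h (measurableSet_singleton 0)

variable {k : ℕ}

/-- The opposite literal. -/
def Literal.neg (l : Literal k) : Literal k := (l.1, !l.2)

theorem Literal.value_neg_ne (a : Fin k → Bool) (l : Literal k) :
    Literal.value a l.neg ≠ Literal.value a l := by
  obtain ⟨i, s⟩ := l
  cases s <;> simp [Literal.neg, Literal.value]

theorem measurableSet_opposite_leaves (j j' : ℕ) :
    MeasurableSet {f : ℕ → TreeData k | (f j).RootIsLeaf ∧ (f j').RootIsLeaf ∧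
      (f j' []).2.2 = Literal.neg (f j []).2.2} := by
  refine .inter (measurableSet_apply_rootIsLeaf j) (.inter
    (measurableSet_apply_rootIsLeaf j') (measurableSet_eq_fun
    (by fun_prop) ?_))
  exact (measurable_of_countable (Literal.neg (k := k))).comp
    (f := fun f : ℕ → TreeData k => (f j []).2.2) (by fun_prop)

variable {p : PMF ℕ} [NeZero k] (hp : ∑' n : ℕ, (n : ℝ≥0∞) * p n = 1) {z : ℝ≥0∞}

theorem forestLaw_rootIsLeaf_and_eq (p : PMF ℕ) (j : ℕ) (l : Literal k) :
    forestLaw p k {f | (f j).RootIsLeaf ∧ (f j []).2.2 = l} = p 0 * (2 * k : ℝ≥0∞)⁻¹ := by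
  have hm : MeasurableSet {t : TreeData k | t.RootIsLeaf ∧ (t []).2.2 = l} :=
    TreeData.measurableSet_rootIsLeaf.inter (measurableSet_eq_fun (by fun_prop) measurable_const)
  rw [← gwLaw_rootIsLeaf_and_eq p k l, ← Measure.infinitePi_map_eval (fun _ : ℕ => gwLaw p k) j,
    Measure.map_apply (measurable_pi_apply j) hm]
  rfl

theorem forestLaw_rootIsLeaf (p : PMF ℕ) (j : ℕ) :
    forestLaw p k {f | (f j).RootIsLeaf} = p 0 := by
  have hm : MeasurableSet {t : TreeData k | t.RootIsLeaf} := TreeData.measurableSet_rootIsLeaf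
  rw [← gwLaw_rootIsLeaf p k, ← Measure.infinitePi_map_eval (fun _ : ℕ => gwLaw p k) j,
    Measure.map_apply (measurable_pi_apply j) hm]
  rfl

theorem forestLaw_opposite_leaves (p : PMF ℕ) {j j' : ℕ} (h : j' ≠ j) :
    forestLaw p k {f | (f j).RootIsLeaf ∧ (f j').RootIsLeaf ∧
      (f j' []).2.2 = Literal.neg (f j []).2.2} = p 0 * (p 0 * (2 * k : ℝ≥0∞)⁻¹) := by
  classical
  have hm := measurableSet_opposite_leaves (k := k) j j'
  rw [← lintegral_indicator_one hm,
    lintegral_forestLaw_update p k j (measurable_one.indicator hm)]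
  have hin : ∀ t : TreeData k, ∫⁻ f, {f : ℕ → TreeData k | (f j).RootIsLeaf ∧ (f j').RootIsLeaf ∧
      (f j' []).2.2 = Literal.neg (f j []).2.2}.indicator 1 (Function.update f j t)
        ∂(forestLaw p k)
      = {t : TreeData k | t.RootIsLeaf}.indicator (fun _ => p 0 * (2 * k : ℝ≥0∞)⁻¹) t := by
    intro t
    by_cases ht : t.RootIsLeaf
    · rw [Set.indicator_of_mem (by exact ht),
        ← forestLaw_rootIsLeaf_and_eq p j' (Literal.neg (t []).2.2), ← lintegral_indicator_one]
      · refine lintegral_congr fun f => ?_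
        simp only [Set.indicator_apply, Set.mem_ofPred_eq, Function.update_self,
          Function.update_of_ne h, ht, true_and, Pi.one_apply]
      · exact .inter (measurableSet_apply_rootIsLeaf j')
          (measurableSet_eq_fun (by fun_prop) measurable_const)
    · rw [Set.indicator_of_notMem (by exact ht)]
      simp [ht]
  simp only [hin]
  rw [lintegral_indicator_const TreeData.measurableSet_rootIsLeaf, gwLaw_rootIsLeaf, mul_comm]

/-- An event `E` on which the children off the backbone are inconsistent lowers the bound on the
conditional tail by the probability of `E`. -/
theorem lintegral_conditionalTail_add_le (hz : 1 ≤ z) {n : ℕ} {A : Set (Fin k → Bool)} {m : ℕ}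
    (hm : m ≠ 0) (s : Finset ℕ) (c : Bool) {E : Set (ℕ → TreeData k)} (hE : MeasurableSet E)
    (hkill : ∀ f ∈ E, A ∩ TreeData.allowedOn s c f = ∅)
    (hone : ∀ B ⊆ A, ∀ m', z ^ m' * spineTail hp n B m' ≤ 1) {b : ℝ≥0∞}
    (hA : bushMoment p z n A ≤ b) :
    ∫⁻ f, conditionalTail hp z n A m s c f ∂(forestLaw p k) + forestLaw p k E ≤ b ^ s.card := by
  classical
  have h1 : ∀ f, conditionalTail hp z n A m s c f + E.indicator 1 f
      ≤ ∏ i ∈ s, z ^ TreeData.count n A (f i) := by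
    intro f
    by_cases hf : f ∈ E
    · have h0 : TreeData.countOn n A s c f = 0 := by
        simp [TreeData.countOn, hkill f hf, TreeData.count_empty]
      rw [conditionalTail, h0, hkill f hf, Nat.sub_zero, spineTail_empty hp n hm,
        Set.indicator_of_mem hf]
      simpa using Finset.one_le_prod' fun i _ => one_le_pow₀ hz
    · rw [Set.indicator_of_notMem hf, add_zero, conditionalTail]
      refine (mul_le_of_le_one_right zero_le (hone _ Set.inter_subset_left _)).trans ?_
      rw [Finset.prod_pow_eq_pow_sum]
      exact pow_le_pow_right₀ hz (countOn_le n A s c f)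
  have h2 := lintegral_add_lintegral_le (μ := forestLaw p k) (measurable_one.indicator hE)
    (.of_forall h1)
  rw [lintegral_indicator_one hE,
    lintegral_forestLaw_prod p k s (measurable_pow_count z n A)] at h2
  exact h2.trans (pow_le_pow_left₀ zero_le hA _)

/-- Once a variable is decided, the backbone is killed at each node with probability at least
`p 0 / (2 k)`, by a leaf child that contradicts the decided literal. -/
theorem pow_mul_spineTail_le_of_decided (hz : 1 ≤ z) (hz' : z ≠ ∞) (hp1 : p 1 = 0)
    {x ρ : ℝ≥0∞} (hρ : ρ ≤ 1)
    (hx : ∀ (n : ℕ) (A : Set (Fin k → Bool)), Decided A → bushMoment p z n A ≤ 1 + x)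
    (hnum : ∑' N : ℕ, N * p N * (1 + x) ^ (N - 1) ≤ ρ + p 0 * (2 * k : ℝ≥0∞)⁻¹)
    (n : ℕ) {A : Set (Fin k → Bool)} (hA : Decided A) {m : ℕ} (hm : m ≠ 0) :
    z ^ m * spineTail hp n A m ≤ ρ := by
  induction n generalizing A m with
  | zero => simp [spineTail_zero_left hp A hm]
  | succ n ih =>
    have hk : (2 * k : ℝ≥0∞) ≠ 0 := by simpa using NeZero.ne k
    have hq : p 0 * (2 * k : ℝ≥0∞)⁻¹ ≠ ∞ :=
      ENNReal.mul_ne_top (p.apply_ne_top 0) (ENNReal.inv_ne_top.2 hk)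
    have hone : ∀ B ⊆ A, ∀ m', z ^ m' * spineTail hp n B m' ≤ 1 := by
      intro B hB m'
      by_cases hm' : m' = 0
      · simpa [hm'] using spineTail_le_one hp n B 0
      · exact (ih (hA.mono hB) hm').trans hρ
    refine (ENNReal.add_le_add_iff_right hq).1 (le_trans ?_ hnum)
    rw [← lintegral_sizeBiasedPair_fst hp]
    refine (add_le_add_left (pow_mul_spineTail_succ_le hp hz hz' n A m) _).trans ?_
    have hstep := lintegral_add_lintegral_le (μ := (sizeBiasedPair p hp).toMeasure)
      (F := fun y => ∫⁻ d, ∫⁻ f, conditionalTail hp z n A m (siblings y) d.2.1 f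
          ∂(forestLaw p k) ∂(nodeLaw p k)) (g := fun _ => p 0 * (2 * k : ℝ≥0∞)⁻¹)
      (G := fun y => (1 + x) ^ (y.1 - 1)) measurable_const ?_
    · simpa using hstep
    filter_upwards [sizeBiasedPair_ae hp] with y hy
    have hy1 : y.1 ≠ 1 := fun h => hy.2 (h ▸ hp1)
    obtain ⟨j, hj⟩ : (siblings y).Nonempty := by
      rw [← Finset.card_pos, card_siblings hy.1]
      omega
    refine lintegral_add_le_of_forall (.of_forall fun d => ?_)
    obtain ⟨l, hl⟩ := hA.exists_ne d.2.1
    rw [← card_siblings hy.1, ← forestLaw_rootIsLeaf_and_eq p j l]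
    refine lintegral_conditionalTail_add_le hp hz hm (siblings y) d.2.1
      (.inter (measurableSet_apply_rootIsLeaf j)
        (measurableSet_eq_fun (by fun_prop) measurable_const)) (fun f hf => ?_) hone (hx n A hA)
    refine Set.subset_eq_empty (Set.inter_subset_inter_right _
      (allowedOn_subset_allowed d.2.1 f hj)) (inter_allowed_eq_empty hf.1 ?_)
    rw [hf.2]
    exact hl

/-- With offspring numbers at least `3`, the backbone is killed at each node with probability at
least a constant times `1 / k`, by two leaf children with opposite literals. -/
theorem pow_mul_spineTail_le (hz : 1 ≤ z) (hz' : z ≠ ∞) {b : ℝ≥0∞}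
    (hb : ∀ (n : ℕ) (A : Set (Fin k → Bool)), bushMoment p z n A ≤ b)
    (hnum : ∑' N : ℕ, N * p N * b ^ (N - 1) ≤ 1 + ∑' N : ℕ, N * p N *
      (if 3 ≤ N then p 0 * (p 0 * (2 * k : ℝ≥0∞)⁻¹) else 0))
    (n : ℕ) (A : Set (Fin k → Bool)) (m : ℕ) :
    z ^ m * spineTail hp n A m ≤ 1 := by
  induction n generalizing A m with
  | zero =>
    by_cases hm : m = 0
    · simpa [hm] using spineTail_le_one hp 0 A 0
    · simp [spineTail_zero_left hp A hm]
  | succ n ih =>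
    by_cases hm : m = 0
    · simpa [hm] using spineTail_le_one hp (n + 1) A 0
    have hk : (2 * k : ℝ≥0∞) ≠ 0 := by simpa using NeZero.ne k
    have hq : p 0 * (p 0 * (2 * k : ℝ≥0∞)⁻¹) ≠ ∞ := ENNReal.mul_ne_top (p.apply_ne_top 0)
      (ENNReal.mul_ne_top (p.apply_ne_top 0) (ENNReal.inv_ne_top.2 hk))
    have hg : ∑' N : ℕ, N * p N * (if 3 ≤ N then p 0 * (p 0 * (2 * k : ℝ≥0∞)⁻¹) else 0) ≠ ∞ := by
      refine ne_top_of_le_ne_top hq (le_trans (b := ∑' N : ℕ, N * p N *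
        (p 0 * (p 0 * (2 * k : ℝ≥0∞)⁻¹))) (ENNReal.tsum_le_tsum fun N => ?_) ?_)
      · gcongr
        split_ifs <;> simp
      · rw [ENNReal.tsum_mul_right, hp, one_mul]
    refine (ENNReal.add_le_add_iff_right hg).1 (le_trans ?_ hnum)
    rw [← lintegral_sizeBiasedPair_fst hp, ← lintegral_sizeBiasedPair_fst hp]
    refine (add_le_add_left (pow_mul_spineTail_succ_le hp hz hz' n A m) _).trans ?_
    refine lintegral_add_lintegral_le (measurable_of_countable _) ?_
    filter_upwards [sizeBiasedPair_ae hp] with y hy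
    refine lintegral_add_le_of_forall (.of_forall fun d => ?_)
    rw [← card_siblings hy.1]
    split_ifs with h3
    · obtain ⟨j, hj, j', hj', hne⟩ : ∃ j ∈ siblings y, ∃ j' ∈ siblings y, j ≠ j' := by
        rw [← Finset.one_lt_card, card_siblings hy.1]
        omega
      rw [← forestLaw_opposite_leaves p hne.symm]
      refine lintegral_conditionalTail_add_le hp hz hm (siblings y) d.2.1
        (measurableSet_opposite_leaves j j') (fun f hf => ?_) (fun B _ m' => ih B m') (hb n A)
      refine Set.eq_empty_of_forall_notMem fun a ha => ?_
      have h1 := ha.2 j hj hf.1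
      have h2 := ha.2 j' hj' hf.2.1
      rw [hf.2.2] at h2
      exact Literal.value_neg_ne a _ (h2.trans h1.symm)
    · have h := lintegral_conditionalTail_add_le hp hz hm (siblings y) d.2.1
        (E := ∅) .empty (fun f hf => absurd hf (Set.notMem_empty f)) (fun B _ m' => ih B m') (hb n A)
      simpa using h

/-- In a binary tree, the only sibling on the backbone is with probability `p 0` a leaf, which
contributes one leaf and decides a variable. For `m ≥ 2` the tail of the rest is then smaller by a
factor `ρ = 1 - σ`, which makes up for the contribution of this leaf and for that of a bush. -/
theorem pow_mul_spineTail_le_of_binary (hz : 1 ≤ z) (hz' : z ≠ ∞) (hp1 : p 1 = 0)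
    (hbin : ∀ N, 3 ≤ N → p N = 0) {b ρ σ : ℝ≥0∞} (hσ : σ ≠ ∞) (hρσ : ρ + σ ≤ 1)
    (hb : ∀ (n : ℕ) (A : Set (Fin k → Bool)), bushMoment p z n A ≤ b)
    (hdec : ∀ (n : ℕ) (A : Set (Fin k → Bool)), Decided A → ∀ m ≠ 0,
      z ^ m * spineTail hp n A m ≤ ρ)
    (hnum : z * b ≤ 1 + z * σ * p 0)
    (n : ℕ) (A : Set (Fin k → Bool)) {m : ℕ} (hm : 2 ≤ m) :
    z ^ m * spineTail hp n A m ≤ 1 := by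
  classical
  induction n generalizing A m with
  | zero => simp [spineTail_zero_left hp A (show m ≠ 0 by omega)]
  | succ n ih =>
    have hq : z * σ * p 0 ≠ ∞ :=
      ENNReal.mul_ne_top (ENNReal.mul_ne_top hz' hσ) (p.apply_ne_top 0)
    refine (ENNReal.add_le_add_iff_right hq).1 (le_trans ?_ hnum)
    refine (add_le_add_left (pow_mul_spineTail_succ_le hp hz hz' n A m) _).trans ?_
    refine lintegral_add_le_of_forall ?_
    filter_upwards [sizeBiasedPair_ae hp] with y hy
    have hy1 : y.1 ≠ 1 := fun h => hy.2 (h ▸ hp1)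
    have hy3 : ¬ 3 ≤ y.1 := fun h => hy.2 (hbin _ h)
    have hy2 : y.1 = 2 := by have := hy.1; omega
    obtain ⟨j, hj⟩ : ∃ j, siblings y = {j} := by
      rw [← Finset.card_eq_one, card_siblings hy.1, hy2]
    refine lintegral_add_le_of_forall (.of_forall fun d => ?_)
    have hpt : ∀ f : ℕ → TreeData k, conditionalTail hp z n A m (siblings y) d.2.1 f
        + {f : ℕ → TreeData k | (f j).RootIsLeaf}.indicator (fun _ => z * σ) f
        ≤ z * ∏ i ∈ {j}, z ^ TreeData.count n A (f i) := by
      intro f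
      rw [hj, Finset.prod_singleton, conditionalTail]
      set C := TreeData.countOn n A {j} d.2.1 f with hC
      have hCle : C ≤ TreeData.count n A (f j) := by
        simpa using countOn_le n A {j} d.2.1 f
      by_cases hf : (f j).RootIsLeaf
      · rw [Set.indicator_of_mem (by exact hf)]
        have hC1 : C ≤ 1 := hCle.trans (TreeData.count_le_one_of_rootIsLeaf n A hf)
        have hd : Decided (A ∩ TreeData.allowedOn {j} d.2.1 f) :=
          (decided_inter_allowed A d.2.1 hf).mono (Set.inter_subset_inter_right _
            (allowedOn_subset_allowed d.2.1 f (Finset.mem_singleton_self j)))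
        calc _ ≤ z ^ 1 * ρ + z * σ := by
              exact add_le_add_left (mul_le_mul' (pow_le_pow_right₀ hz hC1)
                (hdec n _ hd (m - C) (by omega))) _
          _ = z * (ρ + σ) := by rw [pow_one, mul_add]
          _ ≤ z * z ^ TreeData.count n A (f j) := by
              gcongr
              exact hρσ.trans (one_le_pow₀ hz)
      · rw [Set.indicator_of_notMem (by exact hf), add_zero, mul_comm z]
        refine mul_le_mul' (pow_le_pow_right₀ hz hCle) ?_
        by_cases h2 : 2 ≤ m - C
        · exact (ih _ h2).trans hz
        · calc _ ≤ z ^ 1 * 1 := mul_le_mul' (pow_le_pow_right₀ hz (by omega))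
                (spineTail_le_one hp n _ _)
            _ = z := by rw [pow_one, mul_one]
    have hmeas : MeasurableSet {f : ℕ → TreeData k | (f j).RootIsLeaf} :=
      measurableSet_apply_rootIsLeaf j
    have h := lintegral_add_lintegral_le (μ := forestLaw p k)
      (measurable_const.indicator hmeas) (.of_forall hpt)
    rw [lintegral_indicator_const hmeas, forestLaw_rootIsLeaf,
      lintegral_const_mul _ (measurable_prod_pow_count z n A {j}),
      lintegral_forestLaw_prod p k _ (measurable_pow_count z n A), Finset.card_singleton,
      pow_one] at h
    refine h.trans ?_
    gcongr
    exact hb n A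

end SpineBounds

/-! ### Choice of the constants -/

theorem one_add_pow_le_one_add_mul (x : ℝ≥0∞) (n : ℕ) :
    (1 + x) ^ n ≤ 1 + n * x * (1 + x) ^ n := by
  induction n with
  | zero => simp
  | succ n ih =>
    have h1 : 1 ≤ (1 + x) ^ (n + 1) := one_le_pow₀ le_self_add
    calc (1 + x) ^ (n + 1) ≤ (1 + n * x * (1 + x) ^ n) * (1 + x) := by
          rw [pow_succ]; exact mul_le_mul_left ih _
      _ = 1 + x * 1 + n * x * (1 + x) ^ (n + 1) := by ring
      _ ≤ 1 + x * (1 + x) ^ (n + 1) + n * x * (1 + x) ^ (n + 1) := by gcongr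
      _ = 1 + ((n + 1 : ℕ) : ℝ≥0∞) * x * (1 + x) ^ (n + 1) := by push_cast; ring

theorem one_add_pow_le_one_add_mul_add_sq (x : ℝ≥0∞) (n : ℕ) :
    (1 + x) ^ n ≤ 1 + n * x + x ^ 2 * (n ^ 2 * (1 + x) ^ n) := by
  induction n with
  | zero => simp
  | succ n ih =>
    have h1 : 1 ≤ (1 + x) ^ (n + 1) := one_le_pow₀ le_self_add
    calc (1 + x) ^ (n + 1) ≤ (1 + n * x + x ^ 2 * (n ^ 2 * (1 + x) ^ n)) * (1 + x) := by
          rw [pow_succ]; exact mul_le_mul_left ih _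
      _ = 1 + (n + 1) * x + n * x ^ 2 * 1 + x ^ 2 * (n ^ 2 * (1 + x) ^ (n + 1)) := by ring
      _ ≤ 1 + (n + 1) * x + (2 * n + 1) * x ^ 2 * (1 + x) ^ (n + 1)
          + x ^ 2 * (n ^ 2 * (1 + x) ^ (n + 1)) := by
          gcongr
          exact (le_mul_of_one_le_left zero_le (by norm_num)).trans le_self_add
      _ = 1 + ((n + 1 : ℕ) : ℝ≥0∞) * x
          + x ^ 2 * (((n + 1 : ℕ) : ℝ≥0∞) ^ 2 * (1 + x) ^ (n + 1)) := by push_cast; ring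

/-- Second-order expansions at `1` of the generating function and first-order expansion of its
derivative; the exponential moment bounds the remainders. -/
theorem exists_generatingFunction_bounds {p : PMF ℕ} (hp : ∑' n : ℕ, (n : ℝ≥0∞) * p n = 1)
    (hexp : ∃ a : ℝ, 0 < a ∧ Summable fun n : ℕ => Real.exp (a * n) * (p n).toReal) :
    ∃ C x₀ : ℝ, 0 < C ∧ 0 < x₀ ∧ ∀ x : ℝ, 0 ≤ x → x ≤ x₀ →
      ∑' n, p n * (1 + ENNReal.ofReal x) ^ n ≤ ENNReal.ofReal (1 + x + C * x ^ 2) ∧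
      ∑' n : ℕ, n * p n * (1 + ENNReal.ofReal x) ^ (n - 1) ≤ ENNReal.ofReal (1 + C * x) := by
  obtain ⟨a, ha, hsum⟩ := hexp
  set W : ℝ≥0∞ := ∑' n : ℕ, p n * (n ^ 2 * (1 + ENNReal.ofReal (a / 2)) ^ n) with hW
  have hWfin : W ≠ ∞ := by
    have hle : W ≤ ∑' n : ℕ,
        ENNReal.ofReal (8 / a ^ 2 * (Real.exp (a * n) * (p n).toReal)) := by
      refine ENNReal.tsum_le_tsum fun n => ?_
      have hpn : p n = ENNReal.ofReal (p n).toReal := (ENNReal.ofReal_toReal (p.apply_ne_top n)).symm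
      have h1 : (n : ℝ) ^ 2 ≤ 8 / a ^ 2 * Real.exp (a / 2 * n) := by
        have h := Real.quadratic_le_exp_of_nonneg (x := a / 2 * n) (by positivity)
        have h' : (a / 2 * n) ^ 2 / 2 ≤ Real.exp (a / 2 * n) := by
          have : 0 ≤ a / 2 * n := by positivity
          linarith
        calc (n : ℝ) ^ 2 = 8 / a ^ 2 * ((a / 2 * n) ^ 2 / 2) := by field_simp; ring
          _ ≤ _ := by gcongr
      have h2 : (1 + a / 2) ^ n ≤ Real.exp (a / 2 * n) := by
        rw [mul_comm, Real.exp_nat_mul, add_comm]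
        gcongr
        exact Real.add_one_le_exp _
      have h3 : ((n : ℝ≥0∞) ^ 2 * (1 + ENNReal.ofReal (a / 2)) ^ n)
          = ENNReal.ofReal ((n : ℝ) ^ 2 * (1 + a / 2) ^ n) := by
        rw [ENNReal.ofReal_mul (by positivity), ENNReal.ofReal_pow (by positivity),
          ENNReal.ofReal_pow (by positivity), ENNReal.ofReal_add (by positivity) (by positivity),
          ENNReal.ofReal_natCast, ENNReal.ofReal_one]
      rw [h3]
      conv_lhs => rw [hpn]
      rw [← ENNReal.ofReal_mul ENNReal.toReal_nonneg]
      refine ENNReal.ofReal_le_ofReal ?_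
      have h4 : Real.exp (a * n) = Real.exp (a / 2 * n) * Real.exp (a / 2 * n) := by
        rw [← Real.exp_add]; congr 1; ring
      calc (p n).toReal * ((n : ℝ) ^ 2 * (1 + a / 2) ^ n)
          ≤ (p n).toReal * (8 / a ^ 2 * Real.exp (a / 2 * n) * Real.exp (a / 2 * n)) := by gcongr
        _ = _ := by rw [h4]; ring
    refine ne_top_of_le_ne_top ?_ hle
    rw [← ENNReal.ofReal_tsum_of_nonneg (fun n => by positivity) (hsum.mul_left _)]
    exact ENNReal.ofReal_ne_top
  have hWC : W ≤ ENNReal.ofReal (W.toReal + 1) := by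
    rw [ENNReal.le_ofReal_iff_toReal_le hWfin (by positivity)]
    linarith
  refine ⟨W.toReal + 1, a / 2, by positivity, by positivity, fun x hx hxa => ?_⟩
  have hxa' : ENNReal.ofReal x ≤ ENNReal.ofReal (a / 2) := ENNReal.ofReal_le_ofReal hxa
  set X := ENNReal.ofReal x with hX
  constructor
  · calc ∑' n, p n * (1 + X) ^ n
        ≤ ∑' n : ℕ, (p n + n * p n * X
            + p n * (n ^ 2 * (1 + ENNReal.ofReal (a / 2)) ^ n) * X ^ 2) := by
          refine ENNReal.tsum_le_tsum fun n => ?_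
          calc _ ≤ p n * (1 + n * X + X ^ 2 * (n ^ 2 * (1 + ENNReal.ofReal (a / 2)) ^ n)) := by
                gcongr
                refine (one_add_pow_le_one_add_mul_add_sq X n).trans ?_
                gcongr
            _ = _ := by ring
      _ = 1 + X + W * X ^ 2 := by
          rw [ENNReal.tsum_add, ENNReal.tsum_add, ENNReal.tsum_mul_right, ENNReal.tsum_mul_right,
            hp, p.tsum_coe, one_mul]
      _ ≤ 1 + X + ENNReal.ofReal (W.toReal + 1) * X ^ 2 := by gcongr
      _ = _ := by
          rw [hX, ← ENNReal.ofReal_pow hx, ← ENNReal.ofReal_mul (by positivity),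
            ← ENNReal.ofReal_one, ← ENNReal.ofReal_add zero_le_one hx,
            ← ENNReal.ofReal_add (by positivity) (by positivity)]
  · calc ∑' n : ℕ, n * p n * (1 + X) ^ (n - 1)
        ≤ ∑' n : ℕ, (n * p n + p n * (n ^ 2 * (1 + ENNReal.ofReal (a / 2)) ^ n) * X) := by
          refine ENNReal.tsum_le_tsum fun n => ?_
          calc _ ≤ n * p n * (1 + n * X * (1 + ENNReal.ofReal (a / 2)) ^ n) := by
                gcongr
                refine (one_add_pow_le_one_add_mul X (n - 1)).trans ?_
                exact add_le_add le_rfl (mul_le_mul'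
                  (mul_le_mul' (Nat.cast_le.2 (Nat.sub_le n 1)) le_rfl)
                  ((pow_le_pow_right₀ le_self_add (Nat.sub_le n 1)).trans
                    (pow_le_pow_left₀ zero_le (add_le_add le_rfl hxa') n)))
            _ = _ := by ring
      _ = 1 + W * X := by rw [ENNReal.tsum_add, ENNReal.tsum_mul_right, hp]
      _ ≤ 1 + ENNReal.ofReal (W.toReal + 1) * X := by gcongr
      _ = _ := by
          rw [hX, ← ENNReal.ofReal_mul (by positivity), ← ENNReal.ofReal_one,
            ← ENNReal.ofReal_add zero_le_one (by positivity)]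

/-- A critical offspring law that never takes the value `1` gives mass to `0` but is not the point
mass there. -/
theorem PMF.zero_lt_toReal_apply_zero {p : PMF ℕ} (hp : ∑' n : ℕ, (n : ℝ≥0∞) * p n = 1)
    (hp1 : p 1 = 0) : 0 < (p 0).toReal ∧ (p 0).toReal < 1 := by
  have h0 : p 0 ≠ 0 := by
    intro h
    have h2 : (2 : ℝ≥0∞) ≤ 1 := by
      calc (2 : ℝ≥0∞) = ∑' n, 2 * p n := by rw [ENNReal.tsum_mul_left, p.tsum_coe, mul_one]
        _ ≤ ∑' n : ℕ, (n : ℝ≥0∞) * p n := by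
            refine ENNReal.tsum_le_tsum fun n => ?_
            match n with
            | 0 => simp [h]
            | 1 => simp [hp1]
            | n + 2 =>
              gcongr
              push_cast
              exact le_add_self
        _ = 1 := hp
    exact absurd h2 (by norm_num)
  have h1 : p 0 ≠ 1 := by
    intro h
    have hs := (p.apply_eq_one_iff 0).1 h
    have : ∀ n : ℕ, (n : ℝ≥0∞) * p n = 0 := by
      intro n
      by_cases hn : n = 0
      · simp [hn]
      · rw [(p.apply_eq_zero_iff n).2 (by rw [hs]; simpa using hn), mul_zero]
    simp [this] at hp
  refine ⟨ENNReal.toReal_pos h0 (p.apply_ne_top 0), ?_⟩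
  rw [← ENNReal.toReal_one, ENNReal.toReal_lt_toReal (p.apply_ne_top 0) ENNReal.one_ne_top]
  exact lt_of_le_of_ne (p.coe_le_one 0) h1

/-- The parameters `δ / k` of the bounds on the moments and `c / k ^ 2` of the exponential: `δ` is
small compared with the probabilities of killing, and `c` with `δ`. -/
theorem exists_small_parameters {C x₀ q θ : ℝ} (hC : 0 < C) (hx₀ : 0 < x₀) (hq : 0 < q) (hq1 : q < 1)
    (hθ : 0 < θ) :
    ∃ δ c : ℝ, 0 < δ ∧ 0 < c ∧ 2 * δ ≤ x₀ ∧ 16 * C * δ ≤ (1 - q) * q ∧ 4 * C * δ ≤ q ∧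
      4 * C * δ ≤ θ * q ^ 2 ∧ 16 * δ ≤ q ^ 2 ∧ 8 * c ≤ (1 - q) * δ := by
  have h1 : 0 < 1 - q := by linarith
  set δ := min (x₀ / 2) (min ((1 - q) * q / (16 * C)) (min (q / (4 * C))
    (min (θ * q ^ 2 / (4 * C)) (q ^ 2 / 16)))) with hδ
  have hδ0 : 0 < δ := by positivity
  refine ⟨δ, (1 - q) * δ / 8, hδ0, by positivity, ?_, ?_, ?_, ?_, ?_, by linarith⟩
  · have : δ ≤ x₀ / 2 := min_le_left _ _
    linarith
  · have : δ ≤ (1 - q) * q / (16 * C) := (min_le_right _ _).trans (min_le_left _ _)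
    rwa [le_div_iff₀ (by positivity), mul_comm] at this
  · have : δ ≤ q / (4 * C) :=
      (min_le_right _ _).trans ((min_le_right _ _).trans (min_le_left _ _))
    rwa [le_div_iff₀ (by positivity), mul_comm] at this
  · have : δ ≤ θ * q ^ 2 / (4 * C) := (min_le_right _ _).trans ((min_le_right _ _).trans
      ((min_le_right _ _).trans (min_le_left _ _)))
    rwa [le_div_iff₀ (by positivity), mul_comm] at this
  · have : δ ≤ q ^ 2 / 16 := (min_le_right _ _).trans ((min_le_right _ _).trans
      ((min_le_right _ _).trans (min_le_right _ _)))
    linarith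

/-- The inequalities between the parameters used in the bounds on the moments and on the tails, with
`r = 1 / k`. -/
theorem parameter_inequalities {C q θ δ c r : ℝ} (hq : 0 < q) (hq1 : q < 1)
    (hδ : 0 < δ) (hc : 0 < c) (hr : 0 < r) (hr1 : r ≤ 1)
    (hd2 : 16 * C * δ ≤ (1 - q) * q) (hd3 : 4 * C * δ ≤ q) (hd4 : 4 * C * δ ≤ θ * q ^ 2)
    (hd5 : 16 * δ ≤ q ^ 2) (hd6 : 8 * c ≤ (1 - q) * δ) :
    q * Real.exp (c * r ^ 2) + (1 + δ * r + C * (δ * r) ^ 2)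
        ≤ 1 + δ * r + (q + (1 - q) * (q * (r / 2) * (δ * r))) ∧
      q * Real.exp (c * r ^ 2) + (1 + 2 * (δ * r) + C * (2 * (δ * r)) ^ 2)
        ≤ 1 + 2 * (δ * r) + (q + (1 - q) * (q * (δ * r))) ∧
      1 + C * (δ * r) ≤ 1 - q * r / 4 + q * (r / 2) ∧
      1 + C * (2 * (δ * r)) ≤ 1 + θ * (q * (q * (r / 2))) ∧
      Real.exp (c * r ^ 2) * (1 + 2 * (δ * r)) ≤ 1 + Real.exp (c * r ^ 2) * (q * r / 4) * q := by
  have hq1' : 0 < 1 - q := by linarith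
  have hq2 : q ^ 2 ≤ 1 := pow_le_one₀ hq.le hq1.le
  have hcδ : 8 * c ≤ δ := hd6.trans (mul_le_of_le_one_left hδ.le (by linarith))
  have hr2 : r ^ 2 ≤ r := by rw [sq]; exact mul_le_of_le_one_left hr.le hr1
  have hlam : 0 < c * r ^ 2 := by positivity
  have hcr : c * r ^ 2 ≤ c * r := mul_le_mul_of_nonneg_left hr2 hc.le
  have hcr1 : c * r ≤ c := mul_le_of_le_one_right hc.le hr1
  have hZ1 : 1 ≤ Real.exp (c * r ^ 2) := Real.one_le_exp hlam.le
  have hZ2 : Real.exp (c * r ^ 2) ≤ 1 + 2 * (c * r ^ 2) := by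
    have h := Real.abs_exp_sub_one_le (x := c * r ^ 2) (by rw [abs_of_pos hlam]; linarith)
    rw [abs_of_pos hlam, abs_of_nonneg (by linarith)] at h
    linarith
  set Z := Real.exp (c * r ^ 2)
  have e1 : q * Z ≤ q + (1 - q) * q * δ * r ^ 2 / 4 := by
    have h1 := mul_le_mul_of_nonneg_right hd6 (show 0 ≤ q * r ^ 2 by positivity)
    have h2 := mul_le_mul_of_nonneg_left hZ2 hq.le
    linarith
  have e2 : C * (δ * r) ^ 2 ≤ (1 - q) * q * δ * r ^ 2 / 16 := by
    have h1 := mul_le_mul_of_nonneg_right hd2 (show 0 ≤ δ * r ^ 2 by positivity)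
    linarith
  have e3 : 0 ≤ (1 - q) * q * δ * r ^ 2 := by positivity
  have e4 : (1 - q) * q * δ * r ^ 2 ≤ (1 - q) * q * δ * r :=
    mul_le_mul_of_nonneg_left hr2 (by positivity)
  refine ⟨by linarith, by linarith, ?_, ?_, ?_⟩
  · have := mul_le_mul_of_nonneg_right hd3 hr.le
    linarith
  · have := mul_le_mul_of_nonneg_right hd4 hr.le
    linarith
  · have h1 := mul_le_mul_of_nonneg_right hd5 hr.le
    have h2 : 128 * c * r ≤ q ^ 2 * r := mul_le_mul_of_nonneg_right (by linarith) hr.le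
    have h3 : 0 < q ^ 2 * r := by positivity
    have h4 : q ^ 2 * r ≤ 1 := mul_le_one₀ hq2 hr.le hr1
    have h5 : Z * (1 + 2 * (δ * r) - q ^ 2 * r / 4) ≤ Z * (1 - q ^ 2 * r / 8) :=
      mul_le_mul_of_nonneg_left (by linarith) (by linarith)
    have h6 : Z * (1 - q ^ 2 * r / 8) ≤ (1 + q ^ 2 * r / 64) * (1 - q ^ 2 * r / 8) :=
      mul_le_mul_of_nonneg_right (by linarith) (by linarith)
    nlinarith

/-! ### From the truncated counts to the trimmed tree -/

/-- The tail of the size of the trimmed tree is bounded by the tails of the truncated counts. -/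
theorem sampleMeasure_le_of_spineTail_le {p : PMF ℕ} (hp : ∑' n : ℕ, (n : ℝ≥0∞) * p n = 1)
    {k : ℕ} [NeZero k] (ϖ : ℝ) {b : ℝ≥0∞}
    (h : ∀ n, spineTail hp n (Set.univ : Set (Fin k → Bool)) ⌈ϖ⌉₊ ≤ b) :
    sampleMeasure p hp k
      {ω | ENNReal.ofReal ϖ ≤ ((labelledInfiniteGW ω).trimSize : ℝ≥0∞)} ≤ b := by
  let φ : Sample k → (ℕ → ℕ × ℕ) × TreeData k :=
    fun ω => (ω.1, fun u => (ω.2.1 u, ω.2.2.1 u, ω.2.2.2 u))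
  have hφ : Measurable φ := by fun_prop
  let S : ℕ → Set (Sample k) := fun n =>
    {ω | ((⌈ϖ⌉₊ : ℕ) : ℕ∞) ≤ (TreeData.consistentLeaves n Set.univ (spineData (φ ω))).encard}
  have hS : Monotone S := by
    intro n n' hn ω hω
    have hsub : TreeData.consistentLeaves n Set.univ (spineData (φ ω))
        ⊆ TreeData.consistentLeaves n' Set.univ (spineData (φ ω)) :=
      fun u hu => ⟨hu.1.trans_le hn, hu.2⟩
    exact le_trans hω (Set.encard_le_encard hsub)
  have hsub : {ω | ENNReal.ofReal ϖ ≤ ((labelledInfiniteGW ω).trimSize : ℝ≥0∞)} ⊆ ⋃ n, S n := by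
    intro ω hω
    have hm : ((⌈ϖ⌉₊ : ℕ) : ℕ∞) ≤ (spineData (φ ω)).toTree.trimSize := by
      rw [Set.mem_ofPred_eq, ← toTree_spineData] at hω
      change ENNReal.ofReal ϖ ≤ ((spineData (φ ω)).toTree.trimSize : ℝ≥0∞) at hω
      cases hτ : (spineData (φ ω)).toTree.trimSize with
      | top => exact le_top
      | coe j =>
        rw [hτ] at hω
        have hω' : ENNReal.ofReal ϖ ≤ (j : ℝ≥0∞) := hω
        rw [← ENNReal.ofReal_natCast, ENNReal.ofReal_le_ofReal_iff (by positivity)] at hω'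
        exact_mod_cast Nat.ceil_le.2 hω'
    exact Set.mem_iUnion.2 (TreeData.exists_le_encard_of_le_trimSize hm)
  refine (measure_mono hsub).trans ?_
  rw [hS.measure_iUnion]
  refine iSup_le fun n => le_trans ?_ (h n)
  rw [spineTail, ← sampleMeasure_map]
  refine le_trans (measure_mono fun ω hω => ?_) (Measure.le_map_apply hφ.aemeasurable _)
  have := le_trans hω (TreeData.encard_consistentLeaves_le n Set.univ (spineData (φ ω)))
  exact_mod_cast this

theorem le_exp_of_pow_mul_le {c : ℝ} (hc : 0 ≤ c) {t : ℝ≥0∞} {ϖ : ℝ}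
    (h : ENNReal.ofReal (Real.exp c) ^ ⌈ϖ⌉₊ * t ≤ 1) :
    t ≤ ENNReal.ofReal (Real.exp (-(c * ϖ))) := by
  rw [← ENNReal.ofReal_pow (Real.exp_nonneg c), ← Real.exp_nat_mul] at h
  have h0 : ENNReal.ofReal (Real.exp (⌈ϖ⌉₊ * c)) ≠ 0 := by simp [Real.exp_pos]
  have h1 : t ≤ (ENNReal.ofReal (Real.exp (⌈ϖ⌉₊ * c)))⁻¹ := by
    rw [← one_div, ENNReal.le_div_iff_mul_le (Or.inl h0) (Or.inl ENNReal.ofReal_ne_top), mul_comm]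
    exact h
  rw [← ENNReal.ofReal_inv_of_pos (Real.exp_pos _), ← Real.exp_neg] at h1
  refine h1.trans (ENNReal.ofReal_le_ofReal (Real.exp_le_exp.2 (neg_le_neg ?_)))
  rw [mul_comm]
  exact mul_le_mul_of_nonneg_right (Nat.le_ceil ϖ) hc

end

theorem mainTheorem8 (p : PMF ℕ)
    (hmean : ∑' n : ℕ, (n : ℝ≥0∞) * p n = 1)
    (hp1 : p 1 = 0)
    (hexp : ∃ a : ℝ, 0 < a ∧ Summable fun n : ℕ => Real.exp (a * n) * (p n).toReal) :
    ∃ c : ℝ, 0 < c ∧ ∀ (ϖ : ℝ) (k : ℕ) [NeZero k],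
      0 < ϖ → (1 < ϖ ∨ ∃ n : ℕ, 3 ≤ n ∧ p n ≠ 0) →
        sampleMeasure p hmean k
            {ω | ENNReal.ofReal ϖ ≤ ((labelledInfiniteGW ω).trimSize : ℝ≥0∞)}
          ≤ ENNReal.ofReal (Real.exp (-(c * ϖ / (k : ℝ) ^ 2))) := by
  obtain ⟨C, x₀, hC, hx₀, hgf⟩ := exists_generatingFunction_bounds hmean hexp
  obtain ⟨hq, hq1⟩ := PMF.zero_lt_toReal_apply_zero hmean hp1
  set q := (p 0).toReal with hqdef
  have hp0 : p 0 = ENNReal.ofReal q := (ENNReal.ofReal_toReal (p.apply_ne_top 0)).symm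
  -- `θ` is the mass of some value at least `3`, if there is one.
  obtain ⟨θ, hθ, hθp⟩ : ∃ θ : ℝ, 0 < θ ∧
      ((∃ n : ℕ, 3 ≤ n ∧ p n ≠ 0) → ∃ n : ℕ, 3 ≤ n ∧ p n = ENNReal.ofReal θ) := by
    by_cases h : ∃ n : ℕ, 3 ≤ n ∧ p n ≠ 0
    · obtain ⟨n, hn, hpn⟩ := h
      exact ⟨(p n).toReal, ENNReal.toReal_pos hpn (p.apply_ne_top n), fun _ =>
        ⟨n, hn, (ENNReal.ofReal_toReal (p.apply_ne_top n)).symm⟩⟩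
    · exact ⟨1, one_pos, fun h' => absurd h' h⟩
  obtain ⟨δ, c, hδ, hc, hd1, hd2, hd3, hd4, hd5, hd6⟩ :=
    exists_small_parameters hC hx₀ hq hq1 hθ
  refine ⟨c, hc, fun ϖ k _ hϖ hcase => ?_⟩
  have hk1 : (1 : ℝ) ≤ k := by exact_mod_cast Nat.one_le_iff_ne_zero.2 (NeZero.ne k)
  have hk0 : (0 : ℝ) < k := by linarith
  -- In terms of `r = 1 / k`, all the conditions on the parameters are polynomial inequalities.
  set r : ℝ := (k : ℝ)⁻¹ with hr
  have hr0 : 0 < r := by positivity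
  have hr1 : r ≤ 1 := inv_le_one_of_one_le₀ hk1
  set x : ℝ := δ * r with hx
  have hx0 : 0 < x := by positivity
  set lam : ℝ := c * r ^ 2 with hlam
  have hlam0 : 0 < lam := by positivity
  obtain ⟨n1, n2, n3, n4, n5⟩ :=
    parameter_inequalities hq hq1 hδ hc hr0 hr1 hd2 hd3 hd4 hd5 hd6
  have hxδ : x ≤ δ := mul_le_of_le_one_right hδ.le hr1
  set Z : ℝ := Real.exp lam with hZ
  have hZ1 : 1 ≤ Z := Real.one_le_exp hlam0.le
  set z : ℝ≥0∞ := ENNReal.ofReal Z with hz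
  have hz1 : 1 ≤ z := ENNReal.one_le_ofReal.2 hZ1
  have hzt : z ≠ ∞ := ENNReal.ofReal_ne_top
  have hXt : ENNReal.ofReal x ≠ ∞ := ENNReal.ofReal_ne_top
  have hkinv : (2 * k : ℝ≥0∞)⁻¹ = ENNReal.ofReal (r / 2) := by
    rw [show r / 2 = (2 * (k : ℝ))⁻¹ by rw [hr]; field_simp,
      ENNReal.ofReal_inv_of_pos (by positivity), ENNReal.ofReal_mul (by norm_num)]
    simp
  have hp0' : 1 - p 0 = ENNReal.ofReal (1 - q) := by
    rw [hp0, ENNReal.ofReal_sub _ hq.le, ENNReal.ofReal_one]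
  have hxx : 1 + ENNReal.ofReal x + ENNReal.ofReal x = 1 + ENNReal.ofReal (2 * x) := by
    rw [add_assoc, ← ENNReal.ofReal_add hx0.le hx0.le, two_mul]
  obtain ⟨g1, g2⟩ := hgf x hx0.le (by linarith)
  obtain ⟨g3, g4⟩ := hgf (2 * x) (by linarith) (by linarith)
  have hq1' : 0 < 1 - q := by linarith
  have hone : (1 : ℝ≥0∞) = ENNReal.ofReal 1 := ENNReal.ofReal_one.symm
  have b1 : ∀ (n : ℕ) (A : Set (Fin k → Bool)), Decided A →
      bushMoment p z n A ≤ 1 + ENNReal.ofReal x := by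
    refine fun n A hA => bushMoment_le_of_decided p hz1 hp1 hXt ?_ n hA
    refine (add_le_add le_rfl g1).trans ?_
    rw [hp0', hp0, hkinv, hone, hz, ← ENNReal.ofReal_mul hq.le, ← ENNReal.ofReal_mul hq.le,
      ← ENNReal.ofReal_mul (by positivity), ← ENNReal.ofReal_mul (by positivity),
      ← ENNReal.ofReal_add (by positivity) (by positivity),
      ← ENNReal.ofReal_add (by positivity) (by positivity),
      ← ENNReal.ofReal_add (by positivity) (by positivity),
      ← ENNReal.ofReal_add (by positivity) (by positivity)]
    exact ENNReal.ofReal_le_ofReal n1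
  have b2 : ∀ (n : ℕ) (A : Set (Fin k → Bool)),
      bushMoment p z n A ≤ 1 + ENNReal.ofReal x + ENNReal.ofReal x := by
    refine fun n A => bushMoment_le p hz1 hp1 hXt b1 ?_ n A
    rw [hxx]
    refine (add_le_add le_rfl g3).trans ?_
    rw [hp0', hp0, hone, hz, ← ENNReal.ofReal_mul hq.le, ← ENNReal.ofReal_mul hq.le,
      ← ENNReal.ofReal_mul (by positivity),
      ← ENNReal.ofReal_add (by positivity) (by positivity),
      ← ENNReal.ofReal_add (by positivity) (by positivity),
      ← ENNReal.ofReal_add (by positivity) (by positivity),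
      ← ENNReal.ofReal_add (by positivity) (by positivity)]
    exact ENNReal.ofReal_le_ofReal n2
  have hexpo : c * ϖ / (k : ℝ) ^ 2 = lam * ϖ := by
    rw [hlam, hr]; field_simp
  rw [hexpo]
  refine sampleMeasure_le_of_spineTail_le hmean ϖ fun n => le_exp_of_pow_mul_le hlam0.le ?_
  by_cases h3 : ∃ n : ℕ, 3 ≤ n ∧ p n ≠ 0
  · obtain ⟨N, hN, hpN⟩ := hθp h3
    refine pow_mul_spineTail_le hmean hz1 hzt b2 ?_ n Set.univ _
    rw [hxx]
    refine g4.trans ?_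
    have hterm : ENNReal.ofReal θ * (p 0 * (p 0 * (2 * k : ℝ≥0∞)⁻¹)) ≤ ∑' N : ℕ, N * p N *
        (if 3 ≤ N then p 0 * (p 0 * (2 * k : ℝ≥0∞)⁻¹) else 0) := by
      refine le_trans ?_ (ENNReal.le_tsum N)
      rw [if_pos hN, hpN]
      gcongr
      exact le_mul_of_one_le_left zero_le (by exact_mod_cast (by omega : 1 ≤ N))
    refine le_trans ?_ (add_le_add le_rfl hterm)
    rw [hkinv, hp0, hone, ← ENNReal.ofReal_mul hq.le, ← ENNReal.ofReal_mul hq.le,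
      ← ENNReal.ofReal_mul hθ.le, ← ENNReal.ofReal_add (by positivity) (by positivity)]
    exact ENNReal.ofReal_le_ofReal n4
  · have hbin : ∀ N, 3 ≤ N → p N = 0 := fun N hN => by
      by_contra h
      exact h3 ⟨N, hN, h⟩
    have hm : 2 ≤ ⌈ϖ⌉₊ := Nat.lt_ceil.2 (by simpa using hcase.resolve_right h3)
    have hσ1 : q * r ≤ 1 := mul_le_one₀ hq1.le hr0.le hr1
    refine pow_mul_spineTail_le_of_binary hmean hz1 hzt hp1 hbin
      (ρ := ENNReal.ofReal (1 - q * r / 4)) (σ := ENNReal.ofReal (q * r / 4))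
      ENNReal.ofReal_ne_top ?_ b2 (fun n A hA m hm => ?_) ?_ n Set.univ hm
    · rw [← ENNReal.ofReal_add (by linarith) (by positivity), sub_add_cancel, ENNReal.ofReal_one]
    · refine pow_mul_spineTail_le_of_decided hmean hz1 hzt hp1 ?_ b1 ?_ n hA hm
      · exact ENNReal.ofReal_le_one.2 (by linarith [show 0 < q * r by positivity])
      · refine g2.trans ?_
        rw [hkinv, hp0, ← ENNReal.ofReal_mul hq.le,
          ← ENNReal.ofReal_add (by linarith) (by positivity)]
        exact ENNReal.ofReal_le_ofReal n3
    · rw [hxx, hp0, hone, hz, ← ENNReal.ofReal_add (by positivity) (by positivity),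
        ← ENNReal.ofReal_mul (by positivity), ← ENNReal.ofReal_mul (by positivity),
        ← ENNReal.ofReal_mul (by positivity), ← ENNReal.ofReal_add (by positivity) (by positivity)]
      exact ENNReal.ofReal_le_ofReal n5
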